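/- Let $(\mathcal S,\mathcal A,\mathcal P,c,\gamma)$ be a finite Markov decision process with costs $c(s,a)\in[0,1]$, discount factor $\gamma\in(0,1)$, $|\mathcal S|\ge 1$ and $|\mathcal A|\ge 2$. For a randomized stationary policy $\pi$ let $V^\pi(s)=\mathbb E[\sum_{t\ge0}\gamma^t c(S_t,A_t)\mid S_0=s]$ and, for a distribution $\vartheta$ on $\mathcal S$, $f_\vartheta(\pi)=\sum_s\vartheta(s)V^\pi(s)$. A policy $\pi^*$ is optimal if $V^{\pi^*}(s)\le V^\pi(s)$ for all $s$ and $\pi$. **Algorithm.** Stochastic policy mirror descent (SPMD) with the KL divergence starts from the uniform policy $\pi_0$. In iteration $t=0,\dots,k-1$ it follows $\pi_t$ to sample one trajectory $\xi_t=(Z_0,\dots,Z_{n-1})$ of state-action pairs $Z_i=(S_i,A_i)$, whose first pair is arbitrary (it may depend on the past), and sets, for every $s$, $$\pi_{t+1}(\cdot|s)=\operatorname*{arg\,min}_{p\in\Delta_{\mathcal A}}\ \eta\,\langle Q^{\pi_t,\xi_t}(s,\cdot),p\rangle+\sum_a p(a)\log\frac{p(a)}{\pi_t(a|s)} .$$ Here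 $Q^{\pi_t,\xi_t}$ is the single-trajectory truncated on-policy Monte Carlo (TOMC) estimator with threshold $\tau$: if $\pi_t(a|s)<\tau$ then $Q^{\pi_t,\xi_t}(s,a)=\frac1{1-\gamma}$; otherwise $Q^{\pi_t,\xi_t}(s,a)=\sum_{i=h}^{n-1}\gamma^{i-h}c(S_i,A_i)$, where $h\le n-1$ is the first time with $Z_h=(s,a)$, and it is $0$ if there is no such time. **Assumption** (with constants $C>0$, $\rho\in(0,1)$, $\underline\nu\in(0,1]$). Almost surely, for each generated policy $\pi_i$, $i\le k$, the state chain of $\pi_i$ has a stationary distribution $\nu^{\pi_i}$ with $\nu^{\pi_i}(s)\ge\underline\nu$ for all $s$ and $\sum_s|\mathbb P^{\pi_i}(S_t=s\mid S_0=s_0)-\nu^{\pi_i}(s)|\le C\rho^{t+1}$ for all $s_0$ and $t\ge0$. **Parameters.** For $\delta\in(0,1)$ and $k,n\ge1$ put $M=\frac1{1-\gamma}$, $$Z=\frac{4\sqrt{\log(|\mathcal S|k/\delta)}}{1-\gamma},\quad \varepsilon=\frac{2}{1-\gamma}\sqrt{\frac{\log(|\mathcal S|k/\delta)}{k}},\quad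 \tau=|\mathcal A|^{-(2+Z)/(1-\gamma)},$$ $$\eta=\frac{1}{\sqrt k}\min\Big\{\sqrt{\tfrac{2\log|\mathcal A|}{M^2}},\ \log|\mathcal A|\Big\},\quad \zeta^*=\min\Big\{\sqrt{2\log|\mathcal A|\,(1-\gamma)^2},\ \log|\mathcal A|\Big\},$$ $$L=\frac1{1-\gamma}+\frac{\lceil\log_\rho(\underline\nu\tau/(2C))\rceil}{\underline\nu\,\tau},\quad t_{\mathrm{mix}}=\Big\lceil\log_\rho\frac{\underline\nu}{2C}-\frac{(2+Z)\log_\rho|\mathcal A|}{1-\gamma}\Big\rceil,$$ where a ceiling that is not positive is replaced by $1$. Put also $$W=\frac{Z^2}{(1-\gamma)^2}+\frac{M^4(\zeta^*)^2}{4(1-\gamma)^2}+\frac{\log^2|\mathcal A|}{(\zeta^*)^2(1-\gamma)^2}.$$ **Claim.** There are universal constants $c_1,c_2>0$ and $p_1,p_2\in\mathbb N$ such that for every such MDP and all $\delta,C,\rho,\underline\nu$ as above the following holds. 1. Let $k\ge1$ and $n\ge1$ with $n\ge c_1\,L\,\log(|\mathcal A|/\varepsilon)\,(1+\log L)^{p_1}$;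 thus one may take $n=\tilde\Theta\big(L\log(|\mathcal A|/\varepsilon)\big)$. Then for every run of SPMD with these parameters that satisfies the Assumption, with probability at least $1-\delta$, simultaneously for all $\vartheta$ and all optimal $\pi^*$, $$\min_{0\le t\le k-1}f_\vartheta(\pi_t)-f_\vartheta(\pi^*)\le\frac{\log|\mathcal A|}{\zeta^*(1-\gamma)\sqrt k}+\frac{\zeta^*M^2}{2(1-\gamma)\sqrt k}+\frac{Z}{(1-\gamma)\sqrt k}.$$ 2. For every accuracy $0<\epsilon\le\frac1{1-\gamma}$ there are $k,n\ge1$, depending only on $|\mathcal S|,|\mathcal A|,\gamma,\delta,C,\rho,\underline\nu,\epsilon$ and the MDP, with $n$ satisfying the condition of part 1 and $k\le c_2W/\epsilon^2$, such that for every run of SPMD with the parameters above that satisfies the Assumption, with probability at least $1-\delta$, $\min_{0\le t\le k-1}f_\vartheta(\pi_t)-f_\vartheta(\pi^*)\le\epsilon$ for all $\vartheta$ and all optimal $\pi^*$, and the total number $k\cdot n$ of samples satisfies $$k\,n\le c_2\,E\,(1+\log E)^{p_2},\qquad E=\Big(\frac1{1-\gamma}+\frac{t_{\mathrm{mix}}}{\underline\nu}|\mathcal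 A|^{(2+Z)/(1-\gamma)}\Big)\,W\,\frac1{\epsilon^2},$$ that is, $kn=\tilde{\mathcal O}(E)$. Here $Z$, $\varepsilon$, $\tau$, $L$, $t_{\mathrm{mix}}$ and $W$ are those of this $k$. -/

import Mathlib

universe u v w

namespace SPMD

/-- A finite discounted Markov decision process with costs in `[0, 1]`;
`trans s a s'` is the probability of moving from `s` to `s'` under action `a`. -/
structure MDP (S A : Type*) [Fintype S] where
  trans : S → A → S → ℝ
  trans_mem : ∀ s a, trans s a ∈ stdSimplex ℝ S
  cost : S → A → ℝ
  cost_nonneg : ∀ s a, 0 ≤ cost s a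
  cost_le_one : ∀ s a, cost s a ≤ 1
  γ : ℝ
  γ_pos : 0 < γ
  γ_lt_one : γ < 1

/-- Randomized stationary policies; `pol s a` is the probability of `a` at state `s`. -/
def IsPolicy {S A : Type*} [Fintype A] (pol : S → A → ℝ) : Prop :=
  ∀ s, pol s ∈ stdSimplex ℝ A

section MDP

variable {S A : Type*} [Fintype S] [Fintype A] [DecidableEq S] [DecidableEq A]

/-- Transition matrix of the state chain of a policy. -/
def MDP.chain (M : MDP S A) (pol : S → A → ℝ) : Matrix S S ℝ :=
  Matrix.of fun s s' => ∑ a, pol s a * M.trans s a s'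

/-- The probability that `S_t = s'` given `S_0 = s` under the policy. -/
def MDP.stateProb (M : MDP S A) (pol : S → A → ℝ) (t : ℕ) (s s' : S) : ℝ :=
  (M.chain pol ^ t) s s'

/-- The value function: the sum over `t` of `γ ^ t` times the expectation of
`c(S_t, A_t)` given `S_0 = s`. -/
noncomputable def MDP.value (M : MDP S A) (pol : S → A → ℝ) (s : S) : ℝ :=
  ∑' t : ℕ, M.γ ^ t * ∑ s', M.stateProb pol t s s' * ∑ a, pol s' a * M.cost s' a

/-- The objective: the expected value when the initial state has law `θ`. -/
noncomputable def MDP.objective (M : MDP S A) (θ : S → ℝ) (pol : S → A → ℝ) : ℝ :=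
  ∑ s, θ s * M.value pol s

/-- Optimal policies: at every state no policy has a smaller value. -/
def MDP.IsOptimal (M : MDP S A) (pol : S → A → ℝ) : Prop :=
  IsPolicy pol ∧ ∀ pol' : S → A → ℝ, IsPolicy pol' → ∀ s, M.value pol s ≤ M.value pol' s

/-- The state chain of the policy mixes geometrically with constants `(C, ρ)` to a stationary
distribution all of whose entries are at least `νmin`. -/
def MDP.MixingExploring (M : MDP S A) (C ρ νmin : ℝ) (pol : S → A → ℝ) : Prop :=
  ∃ ν ∈ stdSimplex ℝ S,
    (∀ s, ν s = ∑ s', ν s' * M.chain pol s' s) ∧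
    (∀ (s₀ : S) (t : ℕ), ∑ s, |M.stateProb pol t s₀ s - ν s| ≤ C * ρ ^ (t + 1)) ∧
    ∀ s, νmin ≤ ν s

/-- First time `t ≤ n - 1` at which the trajectory visits `z`, and `n` if there is none. -/
noncomputable def hitTime (n : ℕ) (traj : ℕ → S × A) (z : S × A) : ℕ :=
  sInf ({t | t < n ∧ traj t = z} ∪ {n})

/-- On-policy Monte Carlo estimate of the Q-function from one trajectory of length `n`:
the discounted cost from the first visit of `(s, a)` on (and `0` if there is no visit). -/
noncomputable def MDP.omc (M : MDP S A) (n : ℕ) (traj : ℕ → S × A) (s : S) (a : A) : ℝ :=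
  ∑ t ∈ Finset.Ico (hitTime n traj (s, a)) n,
    M.γ ^ (t - hitTime n traj (s, a)) * M.cost (traj t).1 (traj t).2

/-- Truncated on-policy Monte Carlo estimate from a single trajectory, with threshold `τ`. -/
noncomputable def MDP.tomc (M : MDP S A) (n : ℕ) (τ : ℝ) (pol : S → A → ℝ)
    (traj : ℕ → S × A) (s : S) (a : A) : ℝ :=
  if τ ≤ pol s a then M.omc n traj s a else 1 / (1 - M.γ)

/-- Kullback-Leibler divergence on a finite set. It is used only for `q` with positive entries. -/
noncomputable def kl (p q : A → ℝ) : ℝ := ∑ a, p a * Real.log (p a / q a)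

/-- `pol 0, …, pol k` are the policies that `k` iterations of stochastic policy mirror descent
with the KL divergence, constant stepsize `η` and the single-trajectory truncated Monte Carlo
estimator generate from the uniform policy, if the trajectory sampled in iteration `t` is
`data t 0, …, data t (n - 1)`. -/
structure MDP.IsSPMD (M : MDP S A) (k n : ℕ) (η τ : ℝ) (data : ℕ → ℕ → S × A)
    (pol : ℕ → S → A → ℝ) : Prop where
  init : ∀ s a, pol 0 s a = 1 / (Fintype.card A : ℝ)
  mem : ∀ t < k, IsPolicy (pol (t + 1))
  argmin : ∀ t < k, ∀ s,
    IsMinOn (fun p : A → ℝ =>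
        η * ∑ a, M.tomc n τ (pol t) (data t) s a * p a + kl p (pol t s))
      (stdSimplex ℝ A) (pol (t + 1) s)

/-- The random trajectories `ξ t 0, …, ξ t (n - 1)`, `t < k`, on the probability space `(Ω, ℙ)`,
and the policies `pol data t` that the method computes from the sampled data, form a run of the
method: conditionally on the earlier trajectories and on the first `j + 1` pairs of trajectory `t`,
the next state is drawn from the transition kernel and the next action from the current policy.
The first pair of each trajectory is arbitrary; its law may depend on the past. -/
structure MDP.IsRun (M : MDP S A) (k n : ℕ) (η τ : ℝ)
    {Ω : Type*} [MeasurableSpace Ω] (ℙ : MeasureTheory.Measure Ω)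
    (ξ : ℕ → ℕ → Ω → S × A) (pol : (ℕ → ℕ → S × A) → ℕ → S → A → ℝ) : Prop where
  spmd : ∀ data, M.IsSPMD k n η τ data (pol data)
  meas : ∀ t j z, MeasurableSet {ω | ξ t j ω = z}
  law : ∀ t < k, ∀ j, j + 1 < n → ∀ h : ℕ → ℕ → S × A,
    ℙ.real {ω | (∀ i < t, ∀ l < n, ξ i l ω = h i l) ∧ ∀ l ≤ j + 1, ξ t l ω = h t l} =
      ℙ.real {ω | (∀ i < t, ∀ l < n, ξ i l ω = h i l) ∧ ∀ l ≤ j, ξ t l ω = h t l} *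
        (M.trans (h t j).1 (h t j).2 (h t (j + 1)).1 *
          pol h t (h t (j + 1)).1 (h t (j + 1)).2)

/-- The policy of iteration `t` as a random variable. -/
def randomPolicy {Ω : Type*} (ξ : ℕ → ℕ → Ω → S × A)
    (pol : (ℕ → ℕ → S × A) → ℕ → S → A → ℝ) (t : ℕ) (ω : Ω) : S → A → ℝ :=
  pol (fun i j => ξ i j ω) t

/-- Optimality gap of the best of the policies `0, …, k - 1` against `polStar`. -/
noncomputable def MDP.bestGap (M : MDP S A) (k : ℕ) (θ : S → ℝ) (pols : ℕ → S → A → ℝ)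
    (polStar : S → A → ℝ) : ℝ :=
  (⨅ t : Fin k, M.objective θ (pols t)) - M.objective θ polStar

end MDP

/-! Parameters of the method. `nS` and `nA` are the numbers of states and actions. -/

/-- `Z = 4 √(log(|S| k / δ)) / (1 - γ)`. -/
noncomputable def noiseZ (nS k : ℕ) (γ δ : ℝ) : ℝ :=
  4 * √(Real.log (nS * k / δ)) / (1 - γ)

/-- `ε = (2 / (1 - γ)) √(log(|S| k / δ) / k)`. -/
noncomputable def biasLevel (nS k : ℕ) (γ δ : ℝ) : ℝ :=
  2 / (1 - γ) * √(Real.log (nS * k / δ) / k)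

/-- `τ = |A| ^ (-(2 + Z) / (1 - γ))`. -/
noncomputable def threshold (nA : ℕ) (γ Z : ℝ) : ℝ := (nA : ℝ) ^ (-(2 + Z) / (1 - γ))

/-- `η = min {√(2 log |A| / M ^ 2), log |A|} / √k` with `M = 1 / (1 - γ)`. -/
noncomputable def stepsize (nA k : ℕ) (γ : ℝ) : ℝ :=
  min √(2 * Real.log nA / (1 / (1 - γ)) ^ 2) (Real.log nA) / √k

/-- `ζ* = min {√(2 log |A| (1 - γ) ^ 2), log |A|}`. -/
noncomputable def zetaStar (nA : ℕ) (γ : ℝ) : ℝ :=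
  min √(2 * Real.log nA * (1 - γ) ^ 2) (Real.log nA)

/-- `1 / (1 - γ) + ⌈log_ρ (νmin τ / (2 C))⌉ / (νmin τ)`. The ceiling, a number of time steps, is
replaced by `1` if it is not positive, which can happen only for a one-state process. -/
noncomputable def lengthScale (γ C ρ νmin τ : ℝ) : ℝ :=
  1 / (1 - γ) + (max 1 ⌈Real.logb ρ (νmin * τ / (2 * C))⌉ : ℤ) / (νmin * τ)

/-- `t_mix = ⌈log_ρ (νmin / (2 C)) - (2 + Z) log_ρ |A| / (1 - γ)⌉`, with the same convention. -/
noncomputable def mixTime (nA : ℕ) (γ C ρ νmin Z : ℝ) : ℤ :=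
  max 1 ⌈Real.logb ρ (νmin / (2 * C)) - (2 + Z) * Real.logb ρ nA / (1 - γ)⌉

/-- The bound on the optimality gap after `k` iterations, with `M = 1 / (1 - γ)`. -/
noncomputable def gapBound (nA k : ℕ) (γ Z : ℝ) : ℝ :=
  Real.log nA / (zetaStar nA γ * (1 - γ) * √k)
    + zetaStar nA γ * (1 / (1 - γ)) ^ 2 / (2 * (1 - γ) * √k)
    + Z / ((1 - γ) * √k)

/-- `Z² / (1 - γ)² + M⁴ ζ*² / (4 (1 - γ)²) + log² |A| / (ζ*² (1 - γ)²)`, with `M = 1 / (1 - γ)`. -/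
noncomputable def iterScale (nA : ℕ) (γ Z : ℝ) : ℝ :=
  Z ^ 2 / (1 - γ) ^ 2
    + (1 / (1 - γ)) ^ 4 * zetaStar nA γ ^ 2 / (4 * (1 - γ) ^ 2)
    + Real.log nA ^ 2 / (zetaStar nA γ ^ 2 * (1 - γ) ^ 2)

/-- The expression inside the `Õ` of the sample complexity for accuracy `acc`. -/
noncomputable def sampleScale (nA : ℕ) (γ C ρ νmin Z acc : ℝ) : ℝ :=
  (1 / (1 - γ) + mixTime nA γ C ρ νmin Z / νmin * (nA : ℝ) ^ ((2 + Z) / (1 - γ)))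
    * iterScale nA γ Z * (1 / acc ^ 2)

/-- A trajectory length in the class `Θ̃(L log(|A| / ε))`, where `L` is `lengthScale`:
`c * L * log(|A| / ε) * (1 + log L) ^ p`. -/
noncomputable def trajLength (c : ℝ) (p nA : ℕ) (γ C ρ νmin τ ε : ℝ) : ℝ :=
  c * lengthScale γ C ρ νmin τ * Real.log (nA / ε) * (1 + Real.log (lengthScale γ C ρ νmin τ)) ^ p

/-- For every run of the method on `M` with `k` iterations of trajectory length `n`, and `Z, τ, η`
as prescribed for `(k, δ)`, whose policies are almost surely uniformly mixing and exploring with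
constants `(C, ρ, νmin)`: with probability at least `1 - δ` the best-iterate optimality gap is at
most `B`, simultaneously for all initial distributions `θ`. -/
def MDP.HighProbGap {S : Type u} {A : Type v} [Fintype S] [Fintype A]
    [DecidableEq S] [DecidableEq A] (M : MDP S A) (k n : ℕ) (δ C ρ νmin B : ℝ) : Prop :=
  ∀ (Ω : Type w) [MeasurableSpace Ω] (ℙ : MeasureTheory.Measure Ω)
    [MeasureTheory.IsProbabilityMeasure ℙ]
    (ξ : ℕ → ℕ → Ω → S × A) (pol : (ℕ → ℕ → S × A) → ℕ → S → A → ℝ),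
    M.IsRun k n (stepsize (Fintype.card A) k M.γ)
      (threshold (Fintype.card A) M.γ (noiseZ (Fintype.card S) k M.γ δ)) ℙ ξ pol →
    (∀ᵐ ω ∂ℙ, ∀ i ≤ k, M.MixingExploring C ρ νmin (randomPolicy ξ pol i ω)) →
    1 - δ ≤ ℙ.real {ω | ∀ θ ∈ stdSimplex ℝ S, ∀ polStar, M.IsOptimal polStar →
      M.bestGap k θ (fun t => randomPolicy ξ pol t ω) polStar ≤ B}

end SPMD

/-! An optimal policy may be replaced by a deterministic one, `f`, with the same value: play
greedily for its Q-function. The mirror step has a unique minimizer, the exponential reweighting of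
the current policy, so `log π_T(f s | s)` is at least `-log |A|` plus `η` times the accumulated
estimated advantages `⟨Q̂_i, π_i⟩ - Q̂_i(f s)`, up to a second-order term (`MDP.IsSPMD.log_ge`).
True advantages exceed estimated ones by at most a centred sampling error plus a bias
(`MDP.sum_sub_tomc_le`). Truncated entries are harmless: they overestimate Q and, as long as `f s`
itself is not truncated, carry nonnegative weight.

Weighting the states by the discounted occupancy of `f` turns true advantages into value gaps
`V^{π_i} - V^f ≥ 0`. The resulting inequality (`MDP.IsSPMD.sum_occ_neg_log_add_le`) is used twice.
Dropping the value gaps bounds `-log π_T(f s | s)` by `(2 + Z) log |A| / (1 - γ)`, because the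
occupancy of the initial state is at least 1 and the total mass is `1 / (1 - γ)`. This is exactly
the threshold `τ`, and strong induction on `T` shows that `f s` is never truncated. Dropping the
logarithms at `T = k` gives the regret bound.

Bias: the estimator errs only through the part of the horizon cut off after the first visit. Mixing
makes every untruncated pair be hit at the end of each block of steps with probability at least
`νmin τ / 2`, from any start, so long trajectories make this bias at most `ε / 2`. Noise: given the
past and the first pair of a trajectory, the sampling error is bounded and centred. An
Azuma-Hoeffding bound and a union over states and times `T ≤ k` control it without using the mixing
assumption; `f` is fixed beforehand, so no union over comparators is needed.

For the sample complexity, `k ≥ 2` is the least number of iterations whose bound is below the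
accuracy. Failure at `k - 1` bounds `k` by a multiple of `W / acc²`, and logarithms of `|A|`, `1 /
ε` and `L` are absorbed into `log E`. -/

set_option linter.unusedSectionVars false

namespace SPMD

open Finset

/-! ### The entropic mirror step on the simplex. -/

section MirrorDescent

variable {A : Type*} [Fintype A]

theorem sub_le_mul_log_div {x y : ℝ} (hx : 0 ≤ x) (hy : 0 < y) :
    x - y ≤ x * Real.log (x / y) := by
  rcases hx.eq_or_lt with rfl | hx
  · simp; exact hy.le
  · have h := Real.log_le_sub_one_of_pos (div_pos hy hx)
    rw [show Real.log (y / x) = -Real.log (x / y) by rw [← Real.log_inv, inv_div]] at h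
    have h2 : x * (y / x) = y := by field_simp
    nlinarith [mul_le_mul_of_nonneg_left h hx.le]

theorem eq_of_mul_log_div_le {x y : ℝ} (hx : 0 ≤ x) (hy : 0 < y)
    (h : x * Real.log (x / y) ≤ x - y) : x = y := by
  rcases hx.eq_or_lt with rfl | hx
  · simp at h; linarith
  · by_contra hne
    have h1 : y / x ≠ 1 := by
      rw [Ne, div_eq_one_iff_eq hx.ne']; exact fun e => hne e.symm
    have h := Real.log_lt_sub_one_of_pos (div_pos hy hx) h1
    rw [show Real.log (y / x) = -Real.log (x / y) by rw [← Real.log_inv, inv_div]] at h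
    have h2 : x * (y / x) = y := by field_simp
    nlinarith [mul_lt_mul_of_pos_left h hx]

/-- Termwise `x log (x / y) ≥ x - y`, with equality only at `x = y`; the differences `x - y` sum to
zero because both masses are one. -/
theorem eq_of_kl_nonpos {p q : A → ℝ} (hp : p ∈ stdSimplex ℝ A) (hq : q ∈ stdSimplex ℝ A)
    (hpos : ∀ a, 0 < q a) (h : kl p q ≤ 0) : p = q := by
  have h0 : ∑ a, (p a * Real.log (p a / q a) - (p a - q a)) ≤ 0 := by
    rw [sum_sub_distrib, sum_sub_distrib, hp.2, hq.2]
    simpa [kl] using h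
  have hn : ∀ a ∈ (univ : Finset A), 0 ≤ p a * Real.log (p a / q a) - (p a - q a) :=
    fun a _ => sub_nonneg.2 (sub_le_mul_log_div (hp.1 a) (hpos a))
  have hz := (sum_eq_zero_iff_of_nonneg hn).1 (le_antisymm h0 (sum_nonneg hn))
  funext a
  exact eq_of_mul_log_div_le (hp.1 a) (hpos a) (sub_eq_zero.1 (hz a (mem_univ a))).le

/-- The normalized exponential weights `r a * exp (-η * q a)`. -/
noncomputable def gibbs (η : ℝ) (q r : A → ℝ) (a : A) : ℝ :=
  r a * Real.exp (-(η * q a)) / ∑ b, r b * Real.exp (-(η * q b))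

theorem partition_pos [Nonempty A] (η : ℝ) (q : A → ℝ) {r : A → ℝ} (hr : ∀ a, 0 < r a) :
    0 < ∑ b, r b * Real.exp (-(η * q b)) :=
  sum_pos (fun a _ => mul_pos (hr a) (Real.exp_pos _)) univ_nonempty

theorem gibbs_pos [Nonempty A] (η : ℝ) (q : A → ℝ) {r : A → ℝ} (hr : ∀ a, 0 < r a) (a : A) :
    0 < gibbs η q r a :=
  div_pos (mul_pos (hr a) (Real.exp_pos _)) (partition_pos η q hr)

theorem gibbs_mem [Nonempty A] (η : ℝ) (q : A → ℝ) {r : A → ℝ} (hr : ∀ a, 0 < r a) :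
    gibbs η q r ∈ stdSimplex ℝ A := by
  refine ⟨fun a => (gibbs_pos η q hr a).le, ?_⟩
  simp only [gibbs]
  rw [← sum_div, div_self (partition_pos η q hr).ne']

/-- Up to a constant the step minimizes the divergence from the Gibbs weights, which identifies the
minimizer and shows that it is unique. -/
theorem prox_objective_eq [Nonempty A] (η : ℝ) (q : A → ℝ) {r p : A → ℝ} (hr : ∀ a, 0 < r a)
    (hp : p ∈ stdSimplex ℝ A) :
    η * ∑ a, q a * p a + kl p r =
      kl p (gibbs η q r) - Real.log (∑ b, r b * Real.exp (-(η * q b))) := by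
  have hZ := partition_pos η q hr
  set Z := ∑ b, r b * Real.exp (-(η * q b)) with hZdef
  have hterm : ∀ a, p a * Real.log (p a / gibbs η q r a) =
      p a * Real.log (p a / r a) + η * (q a * p a) + p a * Real.log Z := by
    intro a
    rcases (hp.1 a).eq_or_lt with h | h
    · simp [← h]
    · have hra := hr a
      have he := Real.exp_pos (-(η * q a))
      rw [gibbs, ← hZdef, Real.log_div h.ne' (by positivity), Real.log_div (by positivity) hZ.ne',
        Real.log_mul hra.ne' he.ne', Real.log_exp, Real.log_div h.ne' hra.ne']
      ring
  unfold kl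
  rw [sum_congr rfl fun a _ => hterm a, sum_add_distrib, sum_add_distrib, ← sum_mul, hp.2,
    ← mul_sum]
  ring

theorem eq_gibbs_of_isMinOn [Nonempty A] {η : ℝ} {q r p : A → ℝ} (hr : ∀ a, 0 < r a)
    (hp : p ∈ stdSimplex ℝ A)
    (h : IsMinOn (fun p : A → ℝ => η * ∑ a, q a * p a + kl p r) (stdSimplex ℝ A) p) :
    p = gibbs η q r := by
  have hg := gibbs_mem η q hr
  have h1 := h hg
  simp only [Set.mem_ofPred_eq] at h1
  rw [prox_objective_eq η q hr hp, prox_objective_eq η q hr hg] at h1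
  have h2 : kl (gibbs η q r) (gibbs η q r) = 0 := by
    simp [kl, div_self (gibbs_pos η q hr _).ne']
  exact eq_of_kl_nonpos hp hg (gibbs_pos η q hr) (by linarith)

theorem exp_neg_le_quadratic {x : ℝ} (hx : 0 ≤ x) : Real.exp (-x) ≤ 1 - x + x ^ 2 / 2 := by
  have h1 : 1 + x + x ^ 2 / 2 ≤ Real.exp x := Real.quadratic_le_exp_of_nonneg hx
  have h2 : 0 < 1 - x + x ^ 2 / 2 := by nlinarith [sq_nonneg (x - 1)]
  rw [Real.exp_neg, inv_le_comm₀ (Real.exp_pos x) h2]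
  refine le_trans ?_ h1
  rw [inv_le_iff_one_le_mul₀ h2]
  -- `(1 + x + x² / 2)(1 - x + x² / 2) = 1 + x⁴ / 4`.
  nlinarith [sq_nonneg (x ^ 2)]

/-- The log-partition function is at most the partition function minus one, and expanding the
exponentials to second order leaves the mean of `q` and an error `η² B² / 2`. -/
theorem log_gibbs_ge [Nonempty A] {η B : ℝ} {q r : A → ℝ} (hη : 0 ≤ η) (hq : ∀ a, 0 ≤ q a)
    (hB : ∀ a, q a ≤ B) (hr : ∀ a, 0 < r a) (hrs : r ∈ stdSimplex ℝ A) (a : A) :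
    Real.log (r a) + (η * (∑ b, q b * r b - q a) - η ^ 2 * B ^ 2 / 2) ≤
      Real.log (gibbs η q r a) := by
  have hZ := partition_pos η q hr
  have hlog : Real.log (∑ b, r b * Real.exp (-(η * q b))) ≤
      -(η * ∑ b, q b * r b) + η ^ 2 * B ^ 2 / 2 := by
    refine (Real.log_le_sub_one_of_pos hZ).trans ?_
    have : ∑ b, r b * Real.exp (-(η * q b)) ≤
        ∑ b, (r b - η * (q b * r b) + r b * (η ^ 2 * B ^ 2 / 2)) := by
      refine sum_le_sum fun b _ => ?_
      have h1 := exp_neg_le_quadratic (mul_nonneg hη (hq b))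
      have h2 : (η * q b) ^ 2 ≤ η ^ 2 * B ^ 2 := by
        rw [mul_pow]
        exact mul_le_mul_of_nonneg_left (pow_le_pow_left₀ (hq b) (hB b) 2) (sq_nonneg _)
      nlinarith [mul_le_mul_of_nonneg_left h1 (hr b).le, mul_le_mul_of_nonneg_left h2 (hr b).le]
    rw [sum_add_distrib, sum_sub_distrib, ← sum_mul, hrs.2, ← mul_sum] at this
    linarith
  rw [gibbs, Real.log_div (mul_pos (hr a) (Real.exp_pos _)).ne' hZ.ne',
    Real.log_mul (hr a).ne' (Real.exp_pos _).ne', Real.log_exp]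
  linarith

end MirrorDescent

/-! ### Deterministic properties of the estimator and of the iterates. -/

section Run

variable {S A : Type*} [Fintype S] [Fintype A] [DecidableEq S] [DecidableEq A]

theorem MDP.one_sub_γ_pos (M : MDP S A) : 0 < 1 - M.γ := sub_pos.2 M.γ_lt_one

theorem MDP.one_le_horizon (M : MDP S A) : 1 ≤ 1 / (1 - M.γ) := by
  rw [le_div_iff₀ M.one_sub_γ_pos]; linarith [M.γ_pos]

theorem hitTime_congr {n : ℕ} {x y : ℕ → S × A} (h : ∀ l < n, x l = y l) (z : S × A) :
    hitTime n x z = hitTime n y z := by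
  unfold hitTime
  congr 2
  ext t
  simp only [Set.mem_ofPred_eq]
  exact ⟨fun ⟨a, b⟩ => ⟨a, (h t a) ▸ b⟩, fun ⟨a, b⟩ => ⟨a, (h t a).symm ▸ b⟩⟩

theorem MDP.omc_congr (M : MDP S A) {n : ℕ} {x y : ℕ → S × A} (h : ∀ l < n, x l = y l)
    (s : S) (a : A) : M.omc n x s a = M.omc n y s a := by
  unfold MDP.omc
  rw [hitTime_congr h]
  exact sum_congr rfl fun t ht => by rw [h t (mem_Ico.1 ht).2]

theorem MDP.tomc_congr (M : MDP S A) {n : ℕ} {τ : ℝ} (pol : S → A → ℝ) {x y : ℕ → S × A}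
    (h : ∀ l < n, x l = y l) : M.tomc n τ pol x = M.tomc n τ pol y := by
  funext s a
  simp only [MDP.tomc, M.omc_congr h]

theorem MDP.omc_nonneg (M : MDP S A) (n : ℕ) (x : ℕ → S × A) (s : S) (a : A) :
    0 ≤ M.omc n x s a :=
  sum_nonneg fun _ _ => mul_nonneg (pow_nonneg M.γ_pos.le _) (M.cost_nonneg _ _)

theorem MDP.omc_le (M : MDP S A) (n : ℕ) (x : ℕ → S × A) (s : S) (a : A) :
    M.omc n x s a ≤ 1 / (1 - M.γ) := by
  have h1 : M.omc n x s a ≤ ∑ i ∈ range (n - hitTime n x (s, a)), M.γ ^ i := by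
    unfold MDP.omc
    rw [sum_Ico_eq_sum_range]
    refine sum_le_sum fun i _ => ?_
    rw [Nat.add_sub_cancel_left]
    exact mul_le_of_le_one_right (pow_nonneg M.γ_pos.le _) (M.cost_le_one _ _)
  refine h1.trans ?_
  rw [one_div, ← tsum_geometric_of_lt_one M.γ_pos.le M.γ_lt_one]
  exact (summable_geometric_of_lt_one M.γ_pos.le M.γ_lt_one).sum_le_tsum _
    fun i _ => pow_nonneg M.γ_pos.le _

theorem MDP.tomc_nonneg (M : MDP S A) (n : ℕ) (τ : ℝ) (pol : S → A → ℝ) (x : ℕ → S × A)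
    (s : S) (a : A) : 0 ≤ M.tomc n τ pol x s a := by
  unfold MDP.tomc
  split_ifs
  · exact M.omc_nonneg _ _ _ _
  · exact zero_le_one.trans M.one_le_horizon

theorem MDP.tomc_le (M : MDP S A) (n : ℕ) (τ : ℝ) (pol : S → A → ℝ) (x : ℕ → S × A)
    (s : S) (a : A) : M.tomc n τ pol x s a ≤ 1 / (1 - M.γ) := by
  unfold MDP.tomc
  split_ifs
  · exact M.omc_le _ _ _ _
  · exact le_rfl

namespace MDP.IsSPMD

variable {M : MDP S A} {k n : ℕ} {η τ : ℝ} {data data' : ℕ → ℕ → S × A}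
  {pol pol' : ℕ → S → A → ℝ}

theorem pos [Nonempty A] (h : M.IsSPMD k n η τ data pol) {t : ℕ} (ht : t ≤ k) (s : S) (a : A) :
    0 < pol t s a := by
  induction t generalizing a with
  | zero => rw [h.init]; positivity
  | succ t ih =>
    rw [eq_gibbs_of_isMinOn (fun a => ih (Nat.le_of_succ_le ht) a) (h.mem t ht s)
      (h.argmin t ht s)]
    exact gibbs_pos _ _ (fun a => ih (Nat.le_of_succ_le ht) a) a

theorem isPolicy [Nonempty A] (h : M.IsSPMD k n η τ data pol) {t : ℕ} (ht : t ≤ k) :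
    IsPolicy (pol t) := by
  cases t with
  | zero =>
    refine fun s => ⟨fun a => (h.pos ht s a).le, ?_⟩
    simp [h.init]
  | succ t => exact h.mem t ht

theorem succ_eq [Nonempty A] (h : M.IsSPMD k n η τ data pol) {t : ℕ} (ht : t < k) (s : S) :
    pol (t + 1) s = gibbs η (M.tomc n τ (pol t) (data t) s) (pol t s) :=
  eq_gibbs_of_isMinOn (fun a => h.pos ht.le s a) (h.mem t ht s) (h.argmin t ht s)

/-- Uniqueness of the minimizer makes each policy a function of the earlier trajectories alone;
conditioning on the past therefore fixes the policy. -/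
theorem congr [Nonempty A] (h : M.IsSPMD k n η τ data pol) (h' : M.IsSPMD k n η τ data' pol')
    {t : ℕ} (ht : t ≤ k) (hd : ∀ i < t, ∀ l < n, data i l = data' i l) : pol t = pol' t := by
  induction t with
  | zero => funext s a; rw [h.init, h'.init]
  | succ t ih =>
    have e := ih (Nat.le_of_succ_le ht) fun i hi => hd i (hi.trans (Nat.lt_succ_self t))
    funext s
    rw [h.succ_eq ht, h'.succ_eq ht, e, M.tomc_congr _ (hd t (Nat.lt_succ_self t))]

/-- The one-step bound telescopes from the uniform policy. Keeping a bound for each single action,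
rather than only an averaged regret, is what later excludes truncation. -/
theorem log_ge [Nonempty A] (h : M.IsSPMD k n η τ data pol) (hη : 0 ≤ η) {t : ℕ} (ht : t ≤ k)
    (s : S) (a : A) :
    -Real.log (Fintype.card A) + ∑ i ∈ range t,
      (η * (∑ b, M.tomc n τ (pol i) (data i) s b * pol i s b - M.tomc n τ (pol i) (data i) s a)
        - η ^ 2 * (1 / (1 - M.γ)) ^ 2 / 2) ≤ Real.log (pol t s a) := by
  induction t with
  | zero => rw [h.init]; simp
  | succ t ih =>
    rw [sum_range_succ, h.succ_eq ht]
    have h1 := log_gibbs_ge hη (M.tomc_nonneg n τ (pol t) (data t) s)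
      (M.tomc_le n τ (pol t) (data t) s) (fun a => h.pos (Nat.le_of_succ_le ht) s a)
      (h.isPolicy (Nat.le_of_succ_le ht) s) a
    linarith [ih (Nat.le_of_succ_le ht)]

end MDP.IsSPMD

end Run

end SPMD

namespace SPMD

open Finset

/-! ### Discounted occupancies, value functions and performance difference. -/

section Value

variable {S A : Type*} [Fintype S] [Fintype A] [DecidableEq S] [DecidableEq A]
  (M : MDP S A) {pol pol' : S → A → ℝ}

theorem MDP.chain_mem (hpol : IsPolicy pol) :
    M.chain pol ∈ Matrix.rowStochastic ℝ S := by
  rw [Matrix.mem_rowStochastic_iff_sum]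
  refine ⟨fun s s' => sum_nonneg fun a _ =>
    mul_nonneg ((hpol s).1 a) ((M.trans_mem s a).1 s'), fun s => ?_⟩
  simp only [MDP.chain, Matrix.of_apply]
  rw [sum_comm]
  simp [← mul_sum, (M.trans_mem _ _).2, (hpol s).2]

theorem MDP.stateProb_nonneg (hpol : IsPolicy pol) (t : ℕ) (s s' : S) :
    0 ≤ M.stateProb pol t s s' :=
  Matrix.nonneg_of_mem_rowStochastic (pow_mem (M.chain_mem hpol) t)

theorem MDP.sum_stateProb (hpol : IsPolicy pol) (t : ℕ) (s : S) :
    ∑ s', M.stateProb pol t s s' = 1 :=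
  Matrix.sum_row_of_mem_rowStochastic (pow_mem (M.chain_mem hpol) t) s

theorem MDP.stateProb_le_one (hpol : IsPolicy pol) (t : ℕ) (s s' : S) :
    M.stateProb pol t s s' ≤ 1 :=
  Matrix.le_one_of_mem_rowStochastic (pow_mem (M.chain_mem hpol) t)

/-- Expected discounted number of visits to `s'` of the state chain started at `s`. -/
noncomputable def MDP.occ (pol : S → A → ℝ) (s s' : S) : ℝ :=
  ∑' t : ℕ, M.γ ^ t * M.stateProb pol t s s'

theorem MDP.summable_occ (hpol : IsPolicy pol) (s s' : S) :
    Summable fun t : ℕ => M.γ ^ t * M.stateProb pol t s s' :=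
  Summable.of_nonneg_of_le
    (fun t => mul_nonneg (pow_nonneg M.γ_pos.le t) (M.stateProb_nonneg hpol t s s'))
    (fun t => mul_le_of_le_one_right (pow_nonneg M.γ_pos.le t) (M.stateProb_le_one hpol t s s'))
    (summable_geometric_of_lt_one M.γ_pos.le M.γ_lt_one)

theorem MDP.occ_nonneg (hpol : IsPolicy pol) (s s' : S) : 0 ≤ M.occ pol s s' :=
  tsum_nonneg fun t => mul_nonneg (pow_nonneg M.γ_pos.le t) (M.stateProb_nonneg hpol t s s')

theorem MDP.one_le_occ_self (hpol : IsPolicy pol) (s : S) : 1 ≤ M.occ pol s s := by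
  have h := (M.summable_occ hpol s s).sum_le_tsum (range 1) fun t _ =>
    mul_nonneg (pow_nonneg M.γ_pos.le t) (M.stateProb_nonneg hpol t s s)
  simpa [MDP.stateProb, MDP.occ] using h

theorem MDP.sum_occ_mul (hpol : IsPolicy pol) (s : S) (f : S → ℝ) :
    ∑ s', M.occ pol s s' * f s' =
      ∑' t : ℕ, M.γ ^ t * ∑ s', M.stateProb pol t s s' * f s' := by
  simp only [MDP.occ, ← tsum_mul_right]
  rw [← Summable.tsum_finsetSum fun s' _ => (M.summable_occ hpol s s').mul_right _]
  simp only [mul_sum, mul_assoc]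

theorem MDP.sum_occ (hpol : IsPolicy pol) (s : S) :
    ∑ s', M.occ pol s s' = 1 / (1 - M.γ) := by
  have h := M.sum_occ_mul hpol s fun _ => 1
  simp only [mul_one, M.sum_stateProb hpol] at h
  rw [h, tsum_geometric_of_lt_one M.γ_pos.le M.γ_lt_one, one_div]

theorem MDP.occ_eq_left (hpol : IsPolicy pol) (s s' : S) :
    M.occ pol s s' =
      (if s = s' then 1 else 0) + M.γ * ∑ r, M.chain pol s r * M.occ pol r s' := by
  rw [MDP.occ, (M.summable_occ hpol s s').tsum_eq_zero_add]
  congr 1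
  · simp [MDP.stateProb, Matrix.one_apply]
  · simp only [MDP.occ, ← tsum_mul_left]
    rw [← Summable.tsum_finsetSum fun r _ => (M.summable_occ hpol r s').mul_left _,
      ← tsum_mul_left]
    refine tsum_congr fun t => ?_
    rw [MDP.stateProb, pow_succ', pow_succ', Matrix.mul_apply, mul_sum, mul_sum]
    exact sum_congr rfl fun r _ => by rw [MDP.stateProb]; ring

/-- Here the last step is split off, whereas `occ_eq_left` splits off the first. The left form
yields the Bellman equation, the right form the performance difference. -/
theorem MDP.occ_eq_right (hpol : IsPolicy pol) (s s' : S) :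
    M.occ pol s s' =
      (if s = s' then 1 else 0) + M.γ * ∑ r, M.occ pol s r * M.chain pol r s' := by
  rw [M.sum_occ_mul hpol s fun r => M.chain pol r s', MDP.occ,
    (M.summable_occ hpol s s').tsum_eq_zero_add]
  congr 1
  · simp [MDP.stateProb, Matrix.one_apply]
  · rw [← tsum_mul_left]
    refine tsum_congr fun t => ?_
    rw [MDP.stateProb, pow_succ, pow_succ, Matrix.mul_apply]
    simp only [MDP.stateProb]
    ring

theorem MDP.value_eq_sum_occ (hpol : IsPolicy pol) (s : S) :
    M.value pol s = ∑ s', M.occ pol s s' * ∑ a, pol s' a * M.cost s' a :=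
  (M.sum_occ_mul hpol s _).symm

/-- The state-action value function of a policy. -/
noncomputable def MDP.qval (pol : S → A → ℝ) (s : S) (a : A) : ℝ :=
  M.cost s a + M.γ * ∑ s', M.trans s a s' * M.value pol s'

theorem MDP.sum_mul_qval (pol' pol : S → A → ℝ) (s : S) :
    ∑ a, pol' s a * M.qval pol s a =
      ∑ a, pol' s a * M.cost s a + M.γ * ∑ s', M.chain pol' s s' * M.value pol s' := by
  simp only [MDP.qval, mul_add, sum_add_distrib, MDP.chain, Matrix.of_apply, sum_mul]
  rw [sum_comm (γ := S), mul_sum]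
  simp only [mul_sum]
  congr 1
  exact sum_congr rfl fun a _ => sum_congr rfl fun s' _ => by ring

theorem MDP.value_eq_sum_qval (hpol : IsPolicy pol) (s : S) :
    M.value pol s = ∑ a, pol s a * M.qval pol s a := by
  rw [M.sum_mul_qval]
  simp only [M.value_eq_sum_occ hpol]
  have : ∀ s', M.occ pol s s' * ∑ a, pol s' a * M.cost s' a =
      (if s = s' then ∑ a, pol s' a * M.cost s' a else 0) +
        M.γ * ∑ r, M.chain pol s r * (M.occ pol r s' * ∑ a, pol s' a * M.cost s' a) := by
    intro s'
    rw [M.occ_eq_left hpol, add_mul, ite_mul, one_mul, zero_mul, mul_assoc, sum_mul]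
    simp only [mul_assoc]
  rw [sum_congr rfl fun s' _ => this s', sum_add_distrib, sum_ite_eq, if_pos (mem_univ s),
    ← mul_sum, sum_comm]
  simp only [← mul_sum]

theorem MDP.value_nonneg (hpol : IsPolicy pol) (s : S) : 0 ≤ M.value pol s := by
  rw [M.value_eq_sum_occ hpol]
  exact sum_nonneg fun s' _ => mul_nonneg (M.occ_nonneg hpol s s')
    (sum_nonneg fun a _ => mul_nonneg ((hpol s').1 a) (M.cost_nonneg s' a))

theorem MDP.value_le (hpol : IsPolicy pol) (s : S) : M.value pol s ≤ 1 / (1 - M.γ) := by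
  rw [M.value_eq_sum_occ hpol, ← M.sum_occ hpol s]
  refine sum_le_sum fun s' _ => mul_le_of_le_one_right (M.occ_nonneg hpol s s') ?_
  rw [← (hpol s').2]
  exact sum_le_sum fun a _ => mul_le_of_le_one_right ((hpol s').1 a) (M.cost_le_one s' a)

theorem MDP.qval_nonneg (hpol : IsPolicy pol) (s : S) (a : A) : 0 ≤ M.qval pol s a :=
  add_nonneg (M.cost_nonneg s a) (mul_nonneg M.γ_pos.le (sum_nonneg fun s' _ =>
    mul_nonneg ((M.trans_mem s a).1 s') (M.value_nonneg hpol s')))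

theorem MDP.qval_le (hpol : IsPolicy pol) (s : S) (a : A) :
    M.qval pol s a ≤ 1 / (1 - M.γ) := by
  have h : ∑ s', M.trans s a s' * M.value pol s' ≤ 1 / (1 - M.γ) := by
    calc _ ≤ ∑ s', M.trans s a s' * (1 / (1 - M.γ)) := sum_le_sum fun s' _ =>
          mul_le_mul_of_nonneg_left (M.value_le hpol s') ((M.trans_mem s a).1 s')
      _ = _ := by rw [← sum_mul, (M.trans_mem s a).2, one_mul]
  calc M.qval pol s a ≤ 1 + M.γ * (1 / (1 - M.γ)) :=
        add_le_add (M.cost_le_one s a) (mul_le_mul_of_nonneg_left h M.γ_pos.le)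
    _ = 1 / (1 - M.γ) := by field_simp [M.one_sub_γ_pos.ne']; ring

/-- The performance difference lemma. -/
theorem MDP.sum_occ_mul_advantage (hpol : IsPolicy pol) (hpol' : IsPolicy pol') (s : S) :
    ∑ s', M.occ pol' s s' *
        (∑ a, pol s' a * M.qval pol s' a - ∑ a, pol' s' a * M.qval pol s' a) =
      M.value pol s - M.value pol' s := by
  have e : ∀ s', M.occ pol' s s' *
      (∑ a, pol s' a * M.qval pol s' a - ∑ a, pol' s' a * M.qval pol s' a) =
      M.occ pol' s s' * M.value pol s' -
        M.occ pol' s s' * (∑ a, pol' s' a * M.cost s' a) -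
          ∑ r, M.γ * (M.occ pol' s s' * M.chain pol' s' r) * M.value pol r := by
    intro s'
    rw [← M.value_eq_sum_qval hpol, M.sum_mul_qval, mul_sub, mul_add, mul_sum, mul_sum]
    simp only [mul_assoc]
    rw [sub_sub]
    congr 2
    rw [mul_sum]
    exact sum_congr rfl fun r _ => by ring
  rw [sum_congr rfl fun s' _ => e s', sum_sub_distrib, sum_sub_distrib,
    ← M.value_eq_sum_occ hpol', sum_comm]
  simp only [← sum_mul, ← mul_sum]
  -- The occupancy shifted by one step is the occupancy minus a unit mass at the start, so
  -- everything cancels except the value at `s`.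
  have e2 : ∀ r, M.γ * (∑ s', M.occ pol' s s' * M.chain pol' s' r) * M.value pol r =
      M.occ pol' s r * M.value pol r - if s = r then M.value pol r else 0 := by
    intro r
    rw [M.occ_eq_right hpol' s r, add_mul]
    split_ifs <;> ring
  rw [sum_congr rfl fun r _ => e2 r, sum_sub_distrib, sum_ite_eq, if_pos (mem_univ s)]
  ring

/-- The deterministic policy that plays the action `f s` at state `s`. -/
noncomputable def detPolicy (f : S → A) (s : S) (a : A) : ℝ := if a = f s then 1 else 0

theorem isPolicy_detPolicy (f : S → A) : IsPolicy (detPolicy f) := by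
  refine fun s => ⟨fun a => ?_, by simp [detPolicy]⟩
  unfold detPolicy
  split_ifs <;> norm_num

theorem sum_detPolicy_mul (f : S → A) (s : S) (q : A → ℝ) :
    ∑ a, detPolicy f s a * q a = q (f s) := by
  simp [detPolicy]

/-- A greedy policy has nonpositive advantage at every state, so performance difference makes it no
worse. A deterministic comparator requires tracking only one action probability per state. -/
theorem MDP.exists_detPolicy_value_eq [Nonempty A] (h : M.IsOptimal pol) :
    ∃ f : S → A, ∀ s, M.value (detPolicy f) s = M.value pol s := by
  choose f hf using fun s => exists_min_image (univ : Finset A) (M.qval pol s) univ_nonempty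
  refine ⟨f, fun s => le_antisymm ?_ (h.2 _ (isPolicy_detPolicy f) s)⟩
  rw [← sub_nonneg, ← M.sum_occ_mul_advantage h.1 (isPolicy_detPolicy f)]
  refine sum_nonneg fun s' _ => mul_nonneg (M.occ_nonneg (isPolicy_detPolicy f) s s') ?_
  rw [sum_detPolicy_mul, sub_nonneg]
  calc M.qval pol s' (f s') = ∑ a, pol s' a * M.qval pol s' (f s') := by
        rw [← sum_mul, (h.1 s').2, one_mul]
    _ ≤ _ := sum_le_sum fun a _ =>
        mul_le_mul_of_nonneg_left ((hf s').2 a (mem_univ a)) ((h.1 s').1 a)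

end Value

end SPMD

namespace SPMD

open Finset

/-! ### Expectations over finite Markov trajectories, and Hoeffding's lemma. -/

section TrajectoryExpectation

variable {Z : Type*}

/-- The sequence that starts with `z` and continues with `y`. -/
def scons (z : Z) (y : ℕ → Z) : ℕ → Z
  | 0 => z
  | i + 1 => y i

@[simp] theorem scons_zero (z : Z) (y : ℕ → Z) : scons z y 0 = z := rfl

@[simp] theorem scons_succ (z : Z) (y : ℕ → Z) (i : ℕ) : scons z y (i + 1) = y i := rfl

theorem const_eq_scons (z : Z) : (fun _ : ℕ => z) = scons z fun _ => z := by
  funext i; cases i <;> rfl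

variable [Fintype Z]

/-- Expectation of a function of the trajectory of the Markov chain with transition matrix `P`
that starts at `z` and is frozen after `m` steps. -/
noncomputable def trajExp (P : Z → Z → ℝ) : ℕ → Z → ((ℕ → Z) → ℝ) → ℝ
  | 0, z, G => G fun _ => z
  | m + 1, z, G => ∑ z', P z z' * trajExp P m z' fun y => G (scons z y)

/-- `P` is a transition matrix. -/
def IsKernel (P : Z → Z → ℝ) : Prop := ∀ z, P z ∈ stdSimplex ℝ Z

variable {P : Z → Z → ℝ}

theorem trajExp_const (hP : IsKernel P) (m : ℕ) (z : Z) (c : ℝ) :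
    trajExp P m z (fun _ => c) = c := by
  induction m generalizing z with
  | zero => rfl
  | succ m ih => simp only [trajExp, ih]; rw [← sum_mul, (hP z).2, one_mul]

theorem trajExp_mono (hP : IsKernel P) (m : ℕ) (z : Z) {G H : (ℕ → Z) → ℝ}
    (h : ∀ y, G y ≤ H y) : trajExp P m z G ≤ trajExp P m z H := by
  induction m generalizing z G H with
  | zero => exact h _
  | succ m ih =>
    exact sum_le_sum fun z' _ => mul_le_mul_of_nonneg_left (ih z' fun y => h _) ((hP z).1 z')

theorem trajExp_add (m : ℕ) (z : Z) (G H : (ℕ → Z) → ℝ) :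
    trajExp P m z (fun y => G y + H y) = trajExp P m z G + trajExp P m z H := by
  induction m generalizing z G H with
  | zero => rfl
  | succ m ih => simp only [trajExp, ih, mul_add, sum_add_distrib]

theorem trajExp_const_mul (m : ℕ) (z : Z) (c : ℝ) (G : (ℕ → Z) → ℝ) :
    trajExp P m z (fun y => c * G y) = c * trajExp P m z G := by
  induction m generalizing z G with
  | zero => rfl
  | succ m ih =>
    simp only [trajExp, ih, mul_sum]
    exact sum_congr rfl fun z' _ => by ring

theorem trajExp_sum {ι : Type*} (I : Finset ι) (m : ℕ) (z : Z) (G : ι → (ℕ → Z) → ℝ) :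
    trajExp P m z (fun y => ∑ i ∈ I, G i y) = ∑ i ∈ I, trajExp P m z (G i) := by
  induction m generalizing z G with
  | zero => rfl
  | succ m ih =>
    simp only [trajExp, ih, mul_sum]
    rw [sum_comm]

theorem trajExp_congr (m : ℕ) (z : Z) {G H : (ℕ → Z) → ℝ}
    (h : ∀ y, y 0 = z → G y = H y) : trajExp P m z G = trajExp P m z H := by
  cases m with
  | zero => exact h _ rfl
  | succ m => simp only [trajExp, h (scons z _) rfl]

/-- The right side is the chord of the convex function `exp (θ ·)` over `[-c, c]`; its linear term
vanishes for a centred variable. -/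
theorem exp_mul_le_of_abs_le {θ c x : ℝ} (hc : 0 < c) (hx : |x| ≤ c) :
    Real.exp (θ * x) ≤ Real.cosh (θ * c) + Real.sinh (θ * c) / c * x := by
  obtain ⟨h1, h2⟩ := abs_le.1 hx
  have h : Real.exp (((c + x) / (2 * c)) • (θ * c) + ((c - x) / (2 * c)) • -(θ * c)) ≤
      ((c + x) / (2 * c)) • Real.exp (θ * c) + ((c - x) / (2 * c)) • Real.exp (-(θ * c)) :=
    convexOn_exp.2 (Set.mem_univ _) (Set.mem_univ _)
      (div_nonneg (by linarith) (by linarith)) (div_nonneg (by linarith) (by linarith))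
      (by field_simp; ring)
  simp only [smul_eq_mul] at h
  have e : (c + x) / (2 * c) * (θ * c) + (c - x) / (2 * c) * -(θ * c) = θ * x := by
    field_simp; ring
  rw [e] at h
  refine h.trans (le_of_eq ?_)
  rw [Real.cosh_eq, Real.sinh_eq]
  field_simp
  ring

/-- Hoeffding's lemma for trajectories. -/
theorem trajExp_exp_le (hP : IsKernel P) (m : ℕ) (z : Z) {X : (ℕ → Z) → ℝ} {c : ℝ} (hc : 0 < c)
    (hX : ∀ y, |X y| ≤ c) (h0 : trajExp P m z X = 0) (θ : ℝ) :
    trajExp P m z (fun y => Real.exp (θ * X y)) ≤ Real.exp ((θ * c) ^ 2 / 2) := by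
  calc _ ≤ trajExp P m z (fun y => Real.cosh (θ * c) + Real.sinh (θ * c) / c * X y) :=
        trajExp_mono hP m z fun y => exp_mul_le_of_abs_le hc (hX y)
    _ = Real.cosh (θ * c) := by
        rw [trajExp_add, trajExp_const_mul, h0, trajExp_const hP]; simp
    _ ≤ _ := Real.cosh_le_exp_half_sq _

end TrajectoryExpectation

/-! ### Bias of the Monte Carlo estimator: first visits and mixing. -/

section Bias

variable {S A : Type*} [Fintype S] [Fintype A] [DecidableEq S] [DecidableEq A]

theorem hitTime_le (n : ℕ) (y : ℕ → S × A) (x : S × A) : hitTime n y x ≤ n :=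
  Nat.sInf_le (by simp)

theorem hitTime_of_eq {n : ℕ} {y : ℕ → S × A} {x : S × A} (h : y 0 = x) :
    hitTime n y x = 0 := by
  unfold hitTime
  rw [Nat.sInf_eq_zero]
  left
  cases n with
  | zero => simp
  | succ n => left; exact ⟨Nat.succ_pos n, h⟩

theorem hitTime_succ_scons {n : ℕ} {z x : S × A} (h : z ≠ x) (y : ℕ → S × A) :
    hitTime (n + 1) (scons z y) x = hitTime n y x + 1 := by
  have hmem : ∀ (n : ℕ) (y : ℕ → S × A),
      hitTime n y x ∈ ({t | t < n ∧ y t = x} ∪ {n} : Set ℕ) :=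
    fun n y => Nat.sInf_mem ⟨n, by simp⟩
  apply le_antisymm
  · apply Nat.sInf_le
    rcases hmem n y with h1 | h1
    · left; exact ⟨Nat.succ_lt_succ h1.1, h1.2⟩
    · right; rw [Set.mem_singleton_iff] at h1 ⊢; rw [h1]
  · rcases hmem (n + 1) (scons z y) with h1 | h1
    · cases ht : hitTime (n + 1) (scons z y) x with
      | zero => rw [ht] at h1; exact absurd h1.2 h
      | succ t =>
        rw [ht] at h1
        exact Nat.succ_le_succ (Nat.sInf_le (Or.inl ⟨Nat.lt_of_succ_lt_succ h1.1, h1.2⟩))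
    · rw [Set.mem_singleton_iff] at h1
      rw [h1]
      exact Nat.succ_le_succ (hitTime_le n y x)

variable (M : MDP S A) {pol : S → A → ℝ}

/-- Discounted cost of the first `n` pairs of a trajectory. -/
noncomputable def MDP.discountedCost (n : ℕ) (y : ℕ → S × A) : ℝ :=
  ∑ t ∈ range n, M.γ ^ t * M.cost (y t).1 (y t).2

theorem MDP.discountedCost_succ_scons (n : ℕ) (z : S × A) (y : ℕ → S × A) :
    M.discountedCost (n + 1) (scons z y) =
      M.cost z.1 z.2 + M.γ * M.discountedCost n y := by
  simp only [MDP.discountedCost]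
  rw [sum_range_succ', mul_sum, add_comm]
  congr 1
  · simp
  · exact sum_congr rfl fun t _ => by rw [scons_succ]; ring

theorem MDP.omc_of_eq {n : ℕ} {y : ℕ → S × A} {x : S × A} (h : y 0 = x) :
    M.omc n y x.1 x.2 = M.discountedCost n y := by
  simp [MDP.omc, MDP.discountedCost, hitTime_of_eq h]

theorem MDP.omc_succ_scons {n : ℕ} {z x : S × A} (h : z ≠ x) (y : ℕ → S × A) :
    M.omc (n + 1) (scons z y) x.1 x.2 = M.omc n y x.1 x.2 := by
  simp only [MDP.omc]
  rw [hitTime_succ_scons h, ← sum_Ico_add' _ _ _ 1]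
  exact sum_congr rfl fun t _ => by rw [scons_succ, Nat.add_sub_add_right]

/-- Transition matrix of the chain of state-action pairs of a policy. -/
def MDP.pairChain (pol : S → A → ℝ) (z z' : S × A) : ℝ :=
  M.trans z.1 z.2 z'.1 * pol z'.1 z'.2

theorem MDP.sum_pairChain_mul (pol : S → A → ℝ) (z : S × A) (f : S → A → ℝ) :
    ∑ z', M.pairChain pol z z' * f z'.1 z'.2 =
      ∑ s', M.trans z.1 z.2 s' * ∑ a', pol s' a' * f s' a' := by
  rw [Fintype.sum_prod_type]
  simp only [MDP.pairChain, mul_sum, mul_assoc]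

theorem MDP.isKernel_pairChain (hpol : IsPolicy pol) : IsKernel (M.pairChain pol) := by
  refine fun z => ⟨fun z' => mul_nonneg ((M.trans_mem _ _).1 _) ((hpol _).1 _), ?_⟩
  have h := M.sum_pairChain_mul pol z fun _ _ => 1
  simpa [(hpol _).2, (M.trans_mem _ _).2] using h

theorem MDP.qval_eq_sum_pairChain (hpol : IsPolicy pol) (z : S × A) :
    M.qval pol z.1 z.2 =
      M.cost z.1 z.2 + M.γ * ∑ z', M.pairChain pol z z' * M.qval pol z'.1 z'.2 := by
  rw [M.sum_pairChain_mul pol z (M.qval pol), MDP.qval]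
  simp only [← M.value_eq_sum_qval hpol]

theorem sum_mul_mem_Icc {ι : Type*} [Fintype ι] {p f : ι → ℝ} {a b : ℝ}
    (hp : p ∈ stdSimplex ℝ ι) (h : ∀ i, a ≤ f i ∧ f i ≤ b) :
    a ≤ ∑ i, p i * f i ∧ ∑ i, p i * f i ≤ b := by
  constructor
  · calc a = ∑ i, p i * a := by rw [← sum_mul, hp.2, one_mul]
      _ ≤ _ := sum_le_sum fun i _ => mul_le_mul_of_nonneg_left (h i).1 (hp.1 i)
  · calc _ ≤ ∑ i, p i * b := sum_le_sum fun i _ => mul_le_mul_of_nonneg_left (h i).2 (hp.1 i)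
      _ = b := by rw [← sum_mul, hp.2, one_mul]

/-- The difference is the discounted tail of nonnegative costs. A trajectory with `n` transitions
has `n + 1` pairs, hence the exponent. -/
theorem MDP.qval_sub_trajExp_discountedCost (hpol : IsPolicy pol) (n : ℕ) (z : S × A) :
    0 ≤ M.qval pol z.1 z.2 - trajExp (M.pairChain pol) n z (M.discountedCost (n + 1)) ∧
      M.qval pol z.1 z.2 - trajExp (M.pairChain pol) n z (M.discountedCost (n + 1)) ≤
        M.γ ^ (n + 1) * (1 / (1 - M.γ)) := by
  have hk := M.isKernel_pairChain hpol
  induction n generalizing z with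
  | zero =>
    have h := sum_mul_mem_Icc (hk z) (f := fun z' => M.qval pol z'.1 z'.2)
      fun z' => ⟨M.qval_nonneg hpol z'.1 z'.2, M.qval_le hpol z'.1 z'.2⟩
    rw [M.qval_eq_sum_pairChain hpol]
    simp only [trajExp, MDP.discountedCost]
    simp only [zero_add, sum_range_one, pow_zero, one_mul, pow_one, add_sub_cancel_left]
    exact ⟨mul_nonneg M.γ_pos.le h.1, mul_le_mul_of_nonneg_left h.2 M.γ_pos.le⟩
  | succ n ih =>
    have e : M.qval pol z.1 z.2 -
        trajExp (M.pairChain pol) (n + 1) z (M.discountedCost (n + 1 + 1)) =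
        M.γ * ∑ z', M.pairChain pol z z' * (M.qval pol z'.1 z'.2 -
          trajExp (M.pairChain pol) n z' (M.discountedCost (n + 1))) := by
      rw [M.qval_eq_sum_pairChain hpol]
      simp only [trajExp, M.discountedCost_succ_scons, trajExp_add, trajExp_const hk,
        trajExp_const_mul, mul_add, mul_sub, sum_add_distrib, sum_sub_distrib]
      rw [← sum_mul, (hk z).2, mul_sum, mul_sum]
      have : ∀ z', M.pairChain pol z z' * (M.γ * trajExp (M.pairChain pol) n z'
          (M.discountedCost (n + 1))) = M.γ * (M.pairChain pol z z' *
            trajExp (M.pairChain pol) n z' (M.discountedCost (n + 1))) := fun z' => by ring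
      simp only [this]
      ring
    have h := sum_mul_mem_Icc (hk z) (f := fun z' => M.qval pol z'.1 z'.2 -
          trajExp (M.pairChain pol) n z' (M.discountedCost (n + 1))) ih
    rw [e, pow_succ' _ (n + 1), mul_assoc]
    exact ⟨mul_nonneg M.γ_pos.le h.1, mul_le_mul_of_nonneg_left h.2 M.γ_pos.le⟩

/-- The expectation of `γ ^ (n - h)` for the first visit time `h` of `x`
(`h = n` if `x` is not visited before time `n`), when the pair chain starts at `z`. -/
noncomputable def MDP.missFactor (pol : S → A → ℝ) (x : S × A) : ℕ → S × A → ℝ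
  | 0, _ => 1
  | n + 1, z => if z = x then M.γ ^ (n + 1)
      else ∑ z', M.pairChain pol z z' * MDP.missFactor pol x n z'

theorem MDP.missFactor_self (pol : S → A → ℝ) (x : S × A) (n : ℕ) :
    M.missFactor pol x n x = M.γ ^ n := by
  cases n with
  | zero => simp [MDP.missFactor]
  | succ n => simp [MDP.missFactor]

theorem MDP.missFactor_mem (hpol : IsPolicy pol) (x : S × A) (n : ℕ) (z : S × A) :
    M.γ ^ n ≤ M.missFactor pol x n z ∧ M.missFactor pol x n z ≤ 1 := by
  induction n generalizing z with
  | zero => simp [MDP.missFactor]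
  | succ n ih =>
    have h1 : M.γ ^ (n + 1) ≤ M.γ ^ n :=
      pow_le_pow_of_le_one M.γ_pos.le M.γ_lt_one.le (Nat.le_succ n)
    rw [MDP.missFactor]
    split_ifs
    · exact ⟨le_rfl, pow_le_one₀ M.γ_pos.le M.γ_lt_one.le⟩
    · have h := sum_mul_mem_Icc (M.isKernel_pairChain hpol z) ih
      exact ⟨h1.trans h.1, h.2⟩

/-- Until `x` is visited, the error and `missFactor` obey the same averaging recursion. At the visit
only the discounted tail is lost; without a visit the estimate is `0` and the loss is at most the
full horizon, which matches the weight `γ ^ 0`. -/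
theorem MDP.qval_sub_trajExp_omc (hpol : IsPolicy pol) (x : S × A) (n : ℕ) (z : S × A) :
    0 ≤ M.qval pol x.1 x.2 -
        trajExp (M.pairChain pol) n z (fun y => M.omc (n + 1) y x.1 x.2) ∧
      M.qval pol x.1 x.2 - trajExp (M.pairChain pol) n z (fun y => M.omc (n + 1) y x.1 x.2) ≤
        M.missFactor pol x (n + 1) z * (1 / (1 - M.γ)) := by
  have hk := M.isKernel_pairChain hpol
  have hself : ∀ n, trajExp (M.pairChain pol) n x (fun y => M.omc (n + 1) y x.1 x.2) =
      trajExp (M.pairChain pol) n x (M.discountedCost (n + 1)) :=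
    fun n => trajExp_congr n x fun y hy => M.omc_of_eq hy
  induction n generalizing z with
  | zero =>
    by_cases hz : z = x
    · subst hz
      rw [hself, M.missFactor_self]
      exact M.qval_sub_trajExp_discountedCost hpol 0 z
    · have e : M.missFactor pol x (0 + 1) z = 1 := by
        simp only [MDP.missFactor, if_neg hz, mul_one]
        exact (hk z).2
      simp only [trajExp]
      rw [const_eq_scons, M.omc_succ_scons hz, e]
      simp only [MDP.omc, Nat.le_zero.1 (hitTime_le 0 _ x), Ico_self, sum_empty, sub_zero, one_mul]
      exact ⟨M.qval_nonneg hpol _ _, M.qval_le hpol _ _⟩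
  | succ n ih =>
    by_cases hz : z = x
    · subst hz
      rw [hself, M.missFactor_self]
      exact M.qval_sub_trajExp_discountedCost hpol (n + 1) z
    · have e : M.qval pol x.1 x.2 -
          trajExp (M.pairChain pol) (n + 1) z (fun y => M.omc (n + 1 + 1) y x.1 x.2) =
          ∑ z', M.pairChain pol z z' * (M.qval pol x.1 x.2 -
            trajExp (M.pairChain pol) n z' (fun y => M.omc (n + 1) y x.1 x.2)) := by
        simp only [trajExp, M.omc_succ_scons hz, mul_sub, sum_sub_distrib]
        rw [← sum_mul, (hk z).2, one_mul]
      rw [e]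
      refine ⟨sum_nonneg fun z' _ => mul_nonneg ((hk z).1 z') (ih z').1, ?_⟩
      rw [MDP.missFactor, if_neg hz, sum_mul]
      refine sum_le_sum fun z' _ => ?_
      rw [mul_assoc]
      exact mul_le_mul_of_nonneg_left (ih z').2 ((hk z).1 z')

/-- Visits during the first `m` steps are ignored. This only increases the factor, since a visit
gives it the smallest value it can take. -/
theorem MDP.missFactor_add_le (hpol : IsPolicy pol) (x : S × A) (n m : ℕ) (z : S × A) :
    M.missFactor pol x (n + m) z ≤
      ∑ z', (Matrix.of (M.pairChain pol) ^ m) z z' * M.missFactor pol x n z' := by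
  have hk := M.isKernel_pairChain hpol
  induction m generalizing z with
  | zero => simp [Matrix.one_apply]
  | succ m ih =>
    have h1 : M.missFactor pol x (n + m + 1) z ≤
        ∑ z', M.pairChain pol z z' * M.missFactor pol x (n + m) z' := by
      rw [MDP.missFactor]
      split_ifs
      · refine (pow_le_pow_of_le_one M.γ_pos.le M.γ_lt_one.le (Nat.le_succ _)).trans ?_
        exact (sum_mul_mem_Icc (hk z) (M.missFactor_mem hpol x (n + m))).1
      · exact le_rfl
    refine h1.trans ?_
    calc _ ≤ ∑ z', M.pairChain pol z z' *
          ∑ z'', (Matrix.of (M.pairChain pol) ^ m) z' z'' * M.missFactor pol x n z'' :=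
          sum_le_sum fun z' _ => mul_le_mul_of_nonneg_left (ih z') ((hk z).1 z')
      _ = _ := by
        simp only [pow_succ', Matrix.mul_apply, Matrix.of_apply, sum_mul, mul_sum]
        rw [sum_comm]
        simp only [mul_assoc]

theorem MDP.pairChain_pow_succ_apply (m : ℕ) (z x : S × A) :
    (Matrix.of (M.pairChain pol) ^ (m + 1)) z x =
      (∑ r, M.trans z.1 z.2 r * M.stateProb pol m r x.1) * pol x.1 x.2 := by
  induction m generalizing x with
  | zero => simp [MDP.pairChain, MDP.stateProb, Matrix.one_apply]
  | succ m ih =>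
    have hchain : ∀ r, M.stateProb pol (m + 1) r x.1 =
        ∑ r', M.stateProb pol m r r' * M.chain pol r' x.1 := fun r => by
      simp only [MDP.stateProb, pow_succ, Matrix.mul_apply]
    rw [pow_succ, Matrix.mul_apply, Fintype.sum_prod_type]
    simp only [ih, hchain, MDP.pairChain, MDP.chain, Matrix.of_apply, mul_sum, sum_mul]
    conv_rhs => rw [sum_comm]
    refine sum_congr rfl fun r' _ => ?_
    rw [sum_comm]
    exact sum_congr rfl fun r _ => sum_congr rfl fun a _ => by ring

/-- After `m` steps the state law is within `νmin / 2` of stationarity, so the state of `x` has mass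
at least `νmin / 2`; its action then has probability at least `τ`. The extra step of the pair chain
is the transition out of `z`. -/
theorem MDP.le_pairChain_pow (hpol : IsPolicy pol) {C ρ νmin τ : ℝ} {m : ℕ} {x : S × A}
    (hmix : M.MixingExploring C ρ νmin pol) (hν : 0 < νmin) (hτ0 : 0 < τ) (hτ1 : τ ≤ 1)
    (hτ : τ ≤ pol x.1 x.2) (hm : C * ρ ^ (m + 1) ≤ νmin * τ / 2) (z : S × A) :
    νmin * τ / 2 ≤ (Matrix.of (M.pairChain pol) ^ (m + 1)) z x := by
  obtain ⟨ν, -, -, hdist, hmin⟩ := hmix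
  have h1 : ∀ r, νmin / 2 ≤ M.stateProb pol m r x.1 ∧ M.stateProb pol m r x.1 ≤ 1 := by
    refine fun r => ⟨?_, M.stateProb_le_one hpol m r x.1⟩
    have h2 := single_le_sum (f := fun s => |M.stateProb pol m r s - ν s|)
      (fun s _ => abs_nonneg _) (mem_univ x.1)
    have h3 := neg_abs_le (M.stateProb pol m r x.1 - ν x.1)
    have h4 := mul_le_of_le_one_right hν.le hτ1
    have h5 := hdist r m
    have h6 := hmin x.1
    linarith
  have h2 := sum_mul_mem_Icc (M.trans_mem z.1 z.2) h1
  rw [M.pairChain_pow_succ_apply]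
  calc νmin * τ / 2 = νmin / 2 * τ := by ring
    _ ≤ _ := mul_le_mul h2.1 hτ hτ0.le ((half_pos hν).le.trans h2.1)

/-- At the end of each block of `m` steps the chain sits at `x` with probability at least `q`, and
then at least `N` steps remain. Each block thus shrinks the excess over `γ ^ N` by the factor `1 -
q`. -/
theorem MDP.missFactor_le_add_pow (hpol : IsPolicy pol) {x : S × A} {m : ℕ} {q : ℝ}
    (hK : ∀ z, q ≤ (Matrix.of (M.pairChain pol) ^ m) z x) {N j n : ℕ} (hn : N + j * m ≤ n)
    (z : S × A) : M.missFactor pol x n z ≤ M.γ ^ N + (1 - q) ^ j := by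
  have hγ0 := M.γ_pos
  have hKm : Matrix.of (M.pairChain pol) ^ m ∈ Matrix.rowStochastic ℝ (S × A) := by
    refine pow_mem ?_ m
    rw [Matrix.mem_rowStochastic_iff_sum]
    exact ⟨fun z => (M.isKernel_pairChain hpol z).1, fun z => (M.isKernel_pairChain hpol z).2⟩
  have hq1 : q ≤ 1 := (hK z).trans (Matrix.le_one_of_mem_rowStochastic hKm)
  induction j generalizing n z with
  | zero =>
    rw [pow_zero]
    exact (M.missFactor_mem hpol x n z).2.trans (le_add_of_nonneg_left (pow_nonneg hγ0.le N))
  | succ j ih =>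
    have hn' : N + j * m ≤ n - m := by rw [Nat.succ_mul] at hn; omega
    have hmn : m ≤ n := by rw [Nat.succ_mul] at hn; omega
    have h1 := M.missFactor_add_le hpol x (n - m) m z
    rw [Nat.sub_add_cancel hmn] at h1
    set b := M.γ ^ N + (1 - q) ^ j with hb
    set d := M.γ ^ N with hd
    have hbd : d ≤ b := le_add_of_nonneg_right (pow_nonneg (by linarith) j)
    have h2 : ∑ z', (Matrix.of (M.pairChain pol) ^ m) z z' * M.missFactor pol x (n - m) z' ≤
        ∑ z', (Matrix.of (M.pairChain pol) ^ m) z z' * (b - if z' = x then b - d else 0) := by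
      refine sum_le_sum fun z' _ =>
        mul_le_mul_of_nonneg_left ?_ (Matrix.nonneg_of_mem_rowStochastic hKm)
      split_ifs with hz
      · rw [hz, M.missFactor_self, sub_sub_cancel]
        exact pow_le_pow_of_le_one hγ0.le M.γ_lt_one.le (by omega)
      · rw [sub_zero]
        exact ih hn' z'
    simp only [mul_sub, sum_sub_distrib, mul_ite, mul_zero, sum_ite_eq', mem_univ, if_true] at h2
    rw [← sum_mul, Matrix.sum_row_of_mem_rowStochastic hKm, one_mul] at h2
    have h3 : q * (b - d) ≤ (Matrix.of (M.pairChain pol) ^ m) z x * b -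
        (Matrix.of (M.pairChain pol) ^ m) z x * d := by
      rw [← mul_sub]
      exact mul_le_mul_of_nonneg_right (hK z) (sub_nonneg.2 hbd)
    calc _ ≤ b - q * (b - d) := by linarith
      _ = _ := by rw [hb, pow_succ]; ring

/-- The ceiling in `lengthScale` is the block length `m + 1` of the pair chain; replacing
nonpositive ceilings by `1` makes `m` a natural number. -/
theorem mixing_steps {C ρ νmin τ : ℝ} (hC : 0 < C) (hρ0 : 0 < ρ) (hρ1 : ρ < 1) (hν : 0 < νmin)
    (hτ : 0 < τ) : ∃ m : ℕ, C * ρ ^ (m + 1) ≤ νmin * τ / 2 ∧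
      ((max 1 ⌈Real.logb ρ (νmin * τ / (2 * C))⌉ : ℤ) : ℝ) = m + 1 := by
  set c : ℤ := max 1 ⌈Real.logb ρ (νmin * τ / (2 * C))⌉ with hc
  have hc1 : 1 ≤ c := le_max_left _ _
  obtain ⟨m, hm⟩ : ∃ m : ℕ, c = m + 1 := ⟨(c - 1).toNat, by omega⟩
  have hmR : (c : ℝ) = m + 1 := by rw [hm]; push_cast; ring
  refine ⟨m, ?_, hmR⟩
  have hx : 0 < νmin * τ / (2 * C) := by positivity
  have h1 : Real.logb ρ (νmin * τ / (2 * C)) ≤ (m : ℝ) + 1 := by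
    rw [← hmR]
    exact (Int.le_ceil _).trans (by exact_mod_cast le_max_right 1 _)
  have h2 : ρ ^ (m + 1) ≤ νmin * τ / (2 * C) := by
    rw [Real.logb_le_iff_le_rpow_of_base_lt_one hρ0 hρ1 hx] at h1
    exact_mod_cast h1
  calc C * ρ ^ (m + 1) ≤ C * (νmin * τ / (2 * C)) := mul_le_mul_of_nonneg_left h2 hC.le
    _ = νmin * τ / 2 := by field_simp

theorem one_sub_pow_le_exp {q l : ℝ} {j : ℕ} (hq1 : q ≤ 1) (hj : l ≤ q * j) :
    (1 - q) ^ j ≤ Real.exp (-l) := by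
  calc (1 - q) ^ j ≤ Real.exp (-q) ^ j :=
        pow_le_pow_left₀ (by linarith) (by linarith [Real.add_one_le_exp (-q)]) j
    _ = Real.exp (-(q * j)) := by rw [← Real.exp_nat_mul]; ring_nf
    _ ≤ _ := Real.exp_le_exp.2 (neg_le_neg hj)

theorem MDP.missFactor_le_exp (hpol : IsPolicy pol) {C ρ νmin τ l : ℝ} {x : S × A}
    (hmix : M.MixingExploring C ρ νmin pol) (hC : 0 < C) (hρ0 : 0 < ρ) (hρ1 : ρ < 1)
    (hν : 0 < νmin) (hν1 : νmin ≤ 1) (hτ0 : 0 < τ) (hτ1 : τ ≤ 1) (hτ : τ ≤ pol x.1 x.2)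
    (hl : 1 ≤ l) {n : ℕ} (hn : 3 * l * lengthScale M.γ C ρ νmin τ ≤ n) (z : S × A) :
    M.missFactor pol x n z ≤ 2 * Real.exp (-l) := by
  obtain ⟨m, hm, hmc⟩ := mixing_steps hC hρ0 hρ1 hν hτ0
  have hντ : 0 < νmin * τ := mul_pos hν hτ0
  have hντ1 : νmin * τ ≤ 1 := mul_le_one₀ hν1 hτ0.le hτ1
  have hg := M.one_sub_γ_pos
  have hM := M.one_le_horizon
  rw [lengthScale, hmc] at hn
  set H := 1 / (1 - M.γ) with hH
  have hHg : (1 - M.γ) * H = 1 := by rw [hH]; field_simp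
  have hN := Nat.ceil_lt_add_one (a := H * l) (by positivity)
  have hj := Nat.ceil_lt_add_one (a := 2 * l / (νmin * τ)) (by positivity)
  -- `⌈H l⌉` final steps make the discount at most `e^{-l}`, and `⌈2 l / (νmin τ)⌉` blocks make the
  -- miss probability at most `e^{-l}`. The constant 3 absorbs both ceilings because `l ≥ 1`.
  have hlen : ⌈H * l⌉₊ + ⌈2 * l / (νmin * τ)⌉₊ * (m + 1) ≤ n := by
    have h1 : 1 ≤ l / (νmin * τ) := by rw [le_div_iff₀ hντ]; linarith
    have hm0 : (0 : ℝ) < m + 1 := by positivity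
    have h2 : (⌈2 * l / (νmin * τ)⌉₊ : ℝ) ≤ 3 * (l / (νmin * τ)) := by
      rw [mul_div_assoc] at hj; rw [mul_div_assoc]; linarith
    have h3 : (⌈H * l⌉₊ : ℝ) ≤ 3 * l * H := by nlinarith
    have h4 := mul_le_mul_of_nonneg_right h2 hm0.le
    have h5 : 3 * l * (H + ((m : ℝ) + 1) / (νmin * τ)) =
        3 * l * H + 3 * (l / (νmin * τ)) * (m + 1) := by ring
    have : ((⌈H * l⌉₊ + ⌈2 * l / (νmin * τ)⌉₊ * (m + 1) : ℕ) : ℝ) ≤ n := by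
      push_cast; linarith
    exact_mod_cast this
  refine (M.missFactor_le_add_pow hpol
    (M.le_pairChain_pow hpol hmix hν hτ0 hτ1 hτ hm) hlen z).trans ?_
  have e1 : M.γ ^ ⌈H * l⌉₊ ≤ Real.exp (-l) := by
    have h := one_sub_pow_le_exp (q := 1 - M.γ) (l := l) (j := ⌈H * l⌉₊)
      (by linarith [M.γ_pos]) ?_
    · rwa [sub_sub_cancel] at h
    · calc l = (1 - M.γ) * (H * l) := by rw [← mul_assoc, hHg, one_mul]
        _ ≤ _ := mul_le_mul_of_nonneg_left (Nat.le_ceil _) hg.le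
  have e2 : (1 - νmin * τ / 2) ^ ⌈2 * l / (νmin * τ)⌉₊ ≤ Real.exp (-l) := by
    apply one_sub_pow_le_exp (by linarith)
    calc l = νmin * τ / 2 * (2 * l / (νmin * τ)) := by field_simp
      _ ≤ _ := mul_le_mul_of_nonneg_left (Nat.le_ceil _) (half_pos hντ).le
  linarith

end Bias

end SPMD

namespace SPMD

open Finset MeasureTheory

/-! ### Integrals of functions of finitely many sampled pairs. -/

section FiniteData

variable {Z : Type*} [Fintype Z] [DecidableEq Z] {Ω : Type*} [MeasurableSpace Ω]

/-- `g` depends only on the entries of the data with indices in `D`. -/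
def DependsOnCells {β : Type*} (D : Finset (ℕ × ℕ)) (g : (ℕ → ℕ → Z) → β) : Prop :=
  ∀ h h' : ℕ → ℕ → Z, (∀ p ∈ D, h p.1 p.2 = h' p.1 p.2) → g h = g h'

/-- Data with the entries `v` on `D`. -/
def extendData (z₀ : Z) {D : Finset (ℕ × ℕ)} (v : D → Z) (i l : ℕ) : Z :=
  if hp : (i, l) ∈ D then v ⟨(i, l), hp⟩ else z₀

theorem extendData_apply (z₀ : Z) {D : Finset (ℕ × ℕ)} (v : D → Z) (p : D) :
    extendData z₀ v p.1.1 p.1.2 = v p := by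
  simp [extendData, p.2]

/-- The event that the data agree with `v` on `D`. -/
def cylinderEvent (ξ : ℕ → ℕ → Ω → Z) {D : Finset (ℕ × ℕ)} (v : D → Z) : Set Ω :=
  {ω | ∀ p : D, ξ p.1.1 p.1.2 ω = v p}

variable {ξ : ℕ → ℕ → Ω → Z}

theorem measurableSet_cylinderEvent (hξ : ∀ t j z, MeasurableSet {ω | ξ t j ω = z})
    {D : Finset (ℕ × ℕ)} (v : D → Z) : MeasurableSet (cylinderEvent ξ v) := by
  have : cylinderEvent ξ v = ⋂ p : D, {ω | ξ p.1.1 p.1.2 ω = v p} := by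
    ext ω; simp [cylinderEvent]
  rw [this]
  exact MeasurableSet.iInter fun p => hξ _ _ _

/-- Such a function is a simple function on cylinders, so integrability is automatic and integrals
become finite sums, the form in which the law of a run is given. -/
theorem comp_data_eq_sum (z₀ : Z) {D : Finset (ℕ × ℕ)} {g : (ℕ → ℕ → Z) → ℝ}
    (hg : DependsOnCells D g) :
    (fun ω => g fun i j => ξ i j ω) = fun ω => ∑ v : D → Z,
      (cylinderEvent ξ v).indicator (fun _ => g (extendData z₀ v)) ω := by
  funext ω
  rw [sum_eq_single (fun p : D => ξ p.1.1 p.1.2 ω)]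
  · rw [Set.indicator_of_mem (show ω ∈ cylinderEvent ξ _ from fun p => rfl)]
    refine hg _ _ fun p hp => ?_
    rw [extendData_apply z₀ _ (⟨p, hp⟩ : D)]
  · intro v _ hv
    refine Set.indicator_of_notMem (fun hmem => hv ?_) _
    funext p
    exact (hmem p).symm
  · simp

theorem integrable_comp_data [Nonempty Z] (hξ : ∀ t j z, MeasurableSet {ω | ξ t j ω = z})
    (ℙ : Measure Ω) [IsFiniteMeasure ℙ] {D : Finset (ℕ × ℕ)} {g : (ℕ → ℕ → Z) → ℝ}
    (hg : DependsOnCells D g) : Integrable (fun ω => g fun i j => ξ i j ω) ℙ := by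
  rw [comp_data_eq_sum (Classical.arbitrary Z) hg]
  exact integrable_finsetSum _ fun v _ =>
    (integrable_const _).indicator (measurableSet_cylinderEvent hξ v)

theorem integral_comp_data (hξ : ∀ t j z, MeasurableSet {ω | ξ t j ω = z})
    (ℙ : Measure Ω) [IsFiniteMeasure ℙ] (z₀ : Z) {D : Finset (ℕ × ℕ)} {g : (ℕ → ℕ → Z) → ℝ}
    (hg : DependsOnCells D g) :
    ∫ ω, g (fun i j => ξ i j ω) ∂ℙ =
      ∑ v : D → Z, ℙ.real (cylinderEvent ξ v) * g (extendData z₀ v) := by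
  rw [comp_data_eq_sum z₀ hg, integral_finsetSum _ fun v _ =>
    (integrable_const _).indicator (measurableSet_cylinderEvent hξ v)]
  refine sum_congr rfl fun v _ => ?_
  rw [integral_indicator_const _ (measurableSet_cylinderEvent hξ v), smul_eq_mul]

/-- Data with entry `j` of row `t` replaced by `z`. -/
def updateCell (h : ℕ → ℕ → Z) (t j : ℕ) (z : Z) : ℕ → ℕ → Z :=
  Function.update h t (Function.update (h t) j z)

theorem updateCell_self (h : ℕ → ℕ → Z) (t j : ℕ) (z : Z) : updateCell h t j z t j = z := by
  simp [updateCell]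

theorem updateCell_of_ne (h : ℕ → ℕ → Z) {t j i l : ℕ} (z : Z) (hp : (i, l) ≠ (t, j)) :
    updateCell h t j z i l = h i l := by
  unfold updateCell
  by_cases hi : i = t
  · subst hi
    rw [Function.update_self, Function.update_of_ne fun hl => hp (by rw [hl])]
  · rw [Function.update_of_ne hi]

theorem updateCell_eq_self (h : ℕ → ℕ → Z) (t j : ℕ) : updateCell h t j (h t j) = h := by
  simp [updateCell]

theorem DependsOnCells.updateCell {D : Finset (ℕ × ℕ)} {t j : ℕ} {g : (ℕ → ℕ → Z) → ℝ}
    (hg : DependsOnCells (insert (t, j) D) g) (z : Z) :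
    DependsOnCells D fun h => g (updateCell h t j z) := by
  refine fun h h' hh => hg _ _ fun p hp => ?_
  by_cases e : p = (t, j)
  · rw [e, updateCell_self, updateCell_self]
  · rw [updateCell_of_ne _ _ e, updateCell_of_ne _ _ e]
    exact hh p (mem_of_mem_insert_of_ne hp e)

theorem integral_eq_sum_updateCell (hξ : ∀ t j z, MeasurableSet {ω | ξ t j ω = z})
    (ℙ : Measure Ω) [IsFiniteMeasure ℙ] (z₀ : Z) {D : Finset (ℕ × ℕ)} {t j : ℕ}
    {g : (ℕ → ℕ → Z) → ℝ} (hg : DependsOnCells (insert (t, j) D) g) :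
    ∫ ω, g (fun i j => ξ i j ω) ∂ℙ =
      ∑ v : D → Z, ∑ z, ℙ.real (cylinderEvent ξ v ∩ {ω | ξ t j ω = z}) *
        g (updateCell (extendData z₀ v) t j z) := by
  have : Nonempty Z := ⟨z₀⟩
  have e : (fun ω => g fun i j => ξ i j ω) = fun ω => ∑ z,
      {ω | ξ t j ω = z}.indicator (fun ω => g (SPMD.updateCell (fun i j => ξ i j ω) t j z)) ω := by
    funext ω
    rw [sum_eq_single (ξ t j ω)]
    · rw [Set.indicator_of_mem (show ω ∈ {ω' | ξ t j ω' = ξ t j ω} from rfl)]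
      exact congrArg g (updateCell_eq_self (fun i j => ξ i j ω) t j).symm
    · intro z _ hz
      exact Set.indicator_of_notMem (fun h => hz h.symm) _
    · simp
  rw [e, integral_finsetSum _ fun z _ =>
    (integrable_comp_data hξ ℙ (hg.updateCell z)).indicator (hξ t j z), sum_comm]
  refine sum_congr rfl fun z _ => ?_
  rw [integral_indicator (hξ t j z),
    integral_comp_data hξ (ℙ.restrict {ω | ξ t j ω = z}) z₀ (hg.updateCell z)]
  refine sum_congr rfl fun v _ => ?_
  rw [measureReal_restrict_apply (measurableSet_cylinderEvent hξ v)]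

/-- The indices of the first `n` entries of the rows `i < t` and of the first `j` entries
of row `t`. -/
def pastCells (t n j : ℕ) : Finset (ℕ × ℕ) := range t ×ˢ range n ∪ {t} ×ˢ range j

theorem mem_pastCells {t n j i l : ℕ} :
    (i, l) ∈ pastCells t n j ↔ (i < t ∧ l < n) ∨ (i = t ∧ l < j) := by
  simp only [pastCells, mem_union, mem_product, mem_range, mem_singleton]

theorem pastCells_succ (t n j : ℕ) : pastCells t n (j + 1) = insert (t, j) (pastCells t n j) := by
  ext ⟨i, l⟩
  rw [mem_insert, mem_pastCells, mem_pastCells, Prod.mk.injEq]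
  omega

end FiniteData

/-! ### Conditional law of a trajectory given the past. -/

section Tower

variable {S A : Type*} [Fintype S] [Fintype A] [DecidableEq S] [DecidableEq A] [Nonempty A]
  {M : MDP S A} {k n : ℕ} {η τ : ℝ} {Ω : Type*} [MeasurableSpace Ω] {ℙ : Measure Ω}
  {ξ : ℕ → ℕ → Ω → S × A} {pol : (ℕ → ℕ → S × A) → ℕ → S → A → ℝ}

theorem MDP.IsRun.pol_congr (hrun : M.IsRun k n η τ ℙ ξ pol) {t : ℕ} (ht : t ≤ k)
    {h h' : ℕ → ℕ → S × A} (hh : ∀ i < t, ∀ l < n, h i l = h' i l) : pol h t = pol h' t :=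
  (hrun.spmd h).congr (hrun.spmd h') ht hh

theorem MDP.IsRun.nonempty [IsProbabilityMeasure ℙ] (ξ : ℕ → ℕ → Ω → S × A) :
    Nonempty (S × A) := by
  obtain ⟨ω⟩ := nonempty_of_isProbabilityMeasure ℙ
  exact ⟨ξ 0 0 ω⟩

/-- One step of the tower property: on each cylinder the newest pair is integrated out against its
kernel. The current policy is unaffected by that pair because it depends only on earlier rows. The
first pair, of arbitrary law, is never integrated out. -/
theorem MDP.IsRun.integral_step [IsProbabilityMeasure ℙ] (hrun : M.IsRun k n η τ ℙ ξ pol)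
    {t j : ℕ} (ht : t < k) (hj : j + 1 < n) {g : (ℕ → ℕ → S × A) → ℝ}
    (hg : DependsOnCells (pastCells t n (j + 2)) g) :
    ∫ ω, g (fun i j => ξ i j ω) ∂ℙ =
      ∫ ω, (fun h => ∑ z, M.pairChain (pol h t) (h t j) z * g (updateCell h t (j + 1) z))
        (fun i j => ξ i j ω) ∂ℙ := by
  obtain ⟨z₀⟩ := MDP.IsRun.nonempty (ℙ := ℙ) ξ
  rw [pastCells_succ] at hg
  have hpast : DependsOnCells (pastCells t n (j + 1)) fun h : ℕ → ℕ → S × A =>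
      ∑ z, M.pairChain (pol h t) (h t j) z * g (updateCell h t (j + 1) z) := by
    intro h h' hh
    have h1 : pol h t = pol h' t := hrun.pol_congr ht.le fun i hi l hl =>
      hh (i, l) (mem_pastCells.2 (Or.inl ⟨hi, hl⟩))
    have h2 : h t j = h' t j := hh (t, j) (mem_pastCells.2 (Or.inr ⟨rfl, j.lt_succ_self⟩))
    refine sum_congr rfl fun z _ => ?_
    rw [h1, h2, show g (updateCell h t (j + 1) z) = g (updateCell h' t (j + 1) z) from
      hg.updateCell z h h' hh]
  rw [integral_comp_data hrun.meas ℙ z₀ hpast, integral_eq_sum_updateCell hrun.meas ℙ z₀ hg]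
  refine sum_congr rfl fun v _ => ?_
  rw [mul_sum]
  refine sum_congr rfl fun z _ => ?_
  set h := extendData z₀ v with hh
  set h' := updateCell h t (j + 1) z with hh'
  have hpol : pol h' t = pol h t := hrun.pol_congr ht.le fun i hi l _ =>
    updateCell_of_ne h z (by intro e; simp only [Prod.mk.injEq] at e; omega)
  have hne : ∀ l ≤ j, h' t l = h t l := fun l hl =>
    updateCell_of_ne h z (by intro e; simp only [Prod.mk.injEq] at e; omega)
  have hne' : ∀ i < t, ∀ l, h' i l = h i l := fun i hi l =>
    updateCell_of_ne h z (by intro e; simp only [Prod.mk.injEq] at e; omega)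
  have hcyl : cylinderEvent ξ v =
      {ω | (∀ i < t, ∀ l < n, ξ i l ω = h' i l) ∧ ∀ l ≤ j, ξ t l ω = h' t l} := by
    ext ω
    simp only [cylinderEvent, Set.mem_ofPred_eq]
    constructor
    · intro H
      refine ⟨fun i hi l hl => ?_, fun l hl => ?_⟩
      · have hm : (i, l) ∈ pastCells t n (j + 1) := mem_pastCells.2 (Or.inl ⟨hi, hl⟩)
        rw [hne' i hi, H ⟨(i, l), hm⟩, ← extendData_apply z₀ v ⟨(i, l), hm⟩]
      · have hm : (t, l) ∈ pastCells t n (j + 1) :=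
          mem_pastCells.2 (Or.inr ⟨rfl, Nat.lt_succ_of_le hl⟩)
        rw [hne l hl, H ⟨(t, l), hm⟩, ← extendData_apply z₀ v ⟨(t, l), hm⟩]
    · rintro ⟨H1, H2⟩ ⟨⟨i, l⟩, hm⟩
      rw [← extendData_apply z₀ v ⟨(i, l), hm⟩]
      rcases mem_pastCells.1 hm with ⟨hi, hl⟩ | ⟨rfl, hl⟩
      · rw [H1 i hi l hl, hne' i hi]
      · rw [H2 l (Nat.le_of_lt_succ hl), hne l (Nat.le_of_lt_succ hl)]
  have hcyl' : cylinderEvent ξ v ∩ {ω | ξ t (j + 1) ω = z} =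
      {ω | (∀ i < t, ∀ l < n, ξ i l ω = h' i l) ∧ ∀ l ≤ j + 1, ξ t l ω = h' t l} := by
    rw [hcyl]
    ext ω
    simp only [Set.mem_inter_iff, Set.mem_ofPred_eq]
    have hz : h' t (j + 1) = z := updateCell_self _ _ _ _
    constructor
    · rintro ⟨⟨H1, H2⟩, H3⟩
      refine ⟨H1, fun l hl => ?_⟩
      rcases Nat.le_succ_iff.1 hl with h4 | h4
      · exact H2 l h4
      · rw [h4]; exact H3.trans hz.symm
    · rintro ⟨H1, H2⟩
      exact ⟨⟨H1, fun l hl => H2 l (hl.trans (Nat.le_succ j))⟩, (H2 (j + 1) le_rfl).trans hz⟩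
  rw [hcyl', hrun.law t ht j hj h', ← hcyl, hne j le_rfl, hpol, show h' t (j + 1) = z from updateCell_self _ _ _ _,
    mul_assoc]
  rfl

/-- The sequence that agrees with `x` before time `j` and continues with `y`. -/
def splice {Z : Type*} (x : ℕ → Z) (j : ℕ) (y : ℕ → Z) (l : ℕ) : Z :=
  if l < j then x l else y (l - j)

theorem splice_update {Z : Type*} (x y : ℕ → Z) (j : ℕ) (z : Z) :
    splice (Function.update x (j + 1) z) (j + 1) y = splice x j (scons (x j) y) := by
  funext l
  unfold splice
  rcases lt_trichotomy l j with h | h | h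
  · rw [if_pos (by omega), if_pos h, Function.update_of_ne (by omega)]
  · subst h
    rw [if_pos (by omega), if_neg (by omega), Function.update_of_ne (by omega), Nat.sub_self,
      scons_zero]
  · rw [if_neg (by omega), if_neg (by omega), show l - j = (l - (j + 1)) + 1 by omega, scons_succ]

/-- Conditionally on the past and on its first pair, trajectory `t` is a trajectory of the
pair chain of the current policy. -/
theorem MDP.IsRun.integral_eq_trajExp [IsProbabilityMeasure ℙ]
    (hrun : M.IsRun k (n + 1) η τ ℙ ξ pol) {t : ℕ} (ht : t < k) {g : (ℕ → ℕ → S × A) → ℝ}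
    (hg : DependsOnCells (pastCells t (n + 1) (n + 1)) g) :
    ∫ ω, g (fun i j => ξ i j ω) ∂ℙ =
      ∫ ω, (fun h => trajExp (M.pairChain (pol h t)) n (h t 0)
        fun y => g (Function.update h t y)) (fun i j => ξ i j ω) ∂ℙ := by
  -- Here `m` counts the trailing pairs already integrated out; the pairs up to index `j` are still
  -- the sampled ones.
  suffices H : ∀ m j, j + m = n → ∫ ω, g (fun i j => ξ i j ω) ∂ℙ =
      ∫ ω, (fun h => trajExp (M.pairChain (pol h t)) m (h t j)
        fun y => g (Function.update h t (splice (h t) j y))) (fun i j => ξ i j ω) ∂ℙ by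
    have e : ∀ x y : ℕ → S × A, splice x 0 y = y := fun x y => by funext l; simp [splice]
    simpa only [e] using H n 0 (zero_add n)
  intro m
  induction m with
  | zero =>
    intro j hj
    refine integral_congr_ae (Filter.Eventually.of_forall fun ω => ?_)
    refine hg _ _ fun p hp => ?_
    obtain ⟨i, l⟩ := p
    rcases mem_pastCells.1 hp with ⟨hi, hl⟩ | ⟨rfl, hl⟩
    · simp only [Function.update_of_ne hi.ne]
    · simp only [Function.update_self, splice]
      split_ifs with h1
      · rfl
      · rw [show l = j by omega]
  | succ m ih =>
    intro j hj
    refine (ih (j + 1) (by omega)).trans ((hrun.integral_step ht (j := j) (by omega)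
      (g := fun h => trajExp (M.pairChain (pol h t)) m (h t (j + 1))
        fun y => g (Function.update h t (splice (h t) (j + 1) y))) ?_).trans ?_)
    rotate_left
    · refine integral_congr_ae (Filter.Eventually.of_forall fun ω => ?_)
      refine sum_congr rfl fun z _ => ?_
      set h : ℕ → ℕ → S × A := fun i j => ξ i j ω
      have hpol : pol (updateCell h t (j + 1) z) t = pol h t :=
        hrun.pol_congr ht.le fun i hi l _ =>
          updateCell_of_ne h z (by intro e; simp only [Prod.mk.injEq] at e; omega)
      simp only [hpol, updateCell_self]
      simp only [updateCell, Function.update_self, Function.update_idem, splice_update]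
    · intro h h' hh
      have h1 : pol h t = pol h' t := hrun.pol_congr ht.le fun i hi l hl =>
        hh (i, l) (mem_pastCells.2 (Or.inl ⟨hi, hl⟩))
      have h2 : h t (j + 1) = h' t (j + 1) :=
        hh (t, j + 1) (mem_pastCells.2 (Or.inr ⟨rfl, by omega⟩))
      simp only [h1, h2]
      congr 1
      funext y
      refine hg _ _ fun p hp => ?_
      obtain ⟨i, l⟩ := p
      rcases mem_pastCells.1 hp with ⟨hi, hl⟩ | ⟨rfl, hl⟩
      · simp only [Function.update_of_ne hi.ne]
        exact hh (i, l) (mem_pastCells.2 (Or.inl ⟨hi, hl⟩))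
      · simp only [Function.update_self, splice]
        split_ifs with h3
        · exact hh (i, l) (mem_pastCells.2 (Or.inr ⟨rfl, by omega⟩))
        · rfl

end Tower

end SPMD

namespace SPMD

open Finset MeasureTheory

/-! ### Azuma-Hoeffding bound for the sampling errors. -/

section Concentration

variable {S A : Type*} [Fintype S] [Fintype A] [DecidableEq S] [DecidableEq A]
  (M : MDP S A)

/-- Centered sampling error at state `s` of the untruncated entries of the estimator computed
from a trajectory of length `n + 1`, tested against the difference of `pol` and the
deterministic policy `f`. -/
noncomputable def MDP.samplingError (τ : ℝ) (n : ℕ) (f : S → A) (s : S) (pol : S → A → ℝ)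
    (y : ℕ → S × A) : ℝ :=
  ∑ a, (if τ ≤ pol s a then pol s a - detPolicy f s a else 0) *
    (trajExp (M.pairChain pol) n (y 0) (fun w => M.omc (n + 1) w s a) - M.omc (n + 1) y s a)

theorem sum_abs_sub_detPolicy_le {pol : S → A → ℝ} (hpol : IsPolicy pol) (f : S → A) (s : S) :
    ∑ a, |pol s a - detPolicy f s a| ≤ 2 := by
  calc _ ≤ ∑ a, (pol s a + detPolicy f s a) := sum_le_sum fun a _ => by
        have h1 := (hpol s).1 a
        have h2 := (isPolicy_detPolicy f s).1 a
        rw [abs_le]; constructor <;> linarith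
    _ = 2 := by
        rw [sum_add_distrib, (hpol s).2, (isPolicy_detPolicy f s).2]; norm_num

/-- The weights have total variation at most 2, and an estimate and its mean both lie in `[0, 1 / (1
- γ)]`. No factor `|A|` appears. -/
theorem MDP.abs_samplingError_le {pol : S → A → ℝ} (hpol : IsPolicy pol) (τ : ℝ) (n : ℕ)
    (f : S → A) (s : S) (y : ℕ → S × A) :
    |M.samplingError τ n f s pol y| ≤ 2 * (1 / (1 - M.γ)) := by
  have hk := M.isKernel_pairChain hpol
  have hH := zero_le_one.trans M.one_le_horizon
  have hd : ∀ a, |trajExp (M.pairChain pol) n (y 0) (fun w => M.omc (n + 1) w s a) -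
      M.omc (n + 1) y s a| ≤ 1 / (1 - M.γ) := by
    intro a
    have h1 := trajExp_mono hk n (y 0) (G := fun _ => 0) (H := fun w => M.omc (n + 1) w s a)
      fun w => M.omc_nonneg _ _ _ _
    have h2 := trajExp_mono hk n (y 0) (H := fun _ => 1 / (1 - M.γ))
      (G := fun w => M.omc (n + 1) w s a) fun w => M.omc_le _ _ _ _
    rw [trajExp_const hk] at h1 h2
    have h3 := M.omc_nonneg (n + 1) y s a
    have h4 := M.omc_le (n + 1) y s a
    rw [abs_le]; constructor <;> linarith
  calc _ ≤ ∑ a, |(if τ ≤ pol s a then pol s a - detPolicy f s a else 0) *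
        (trajExp (M.pairChain pol) n (y 0) (fun w => M.omc (n + 1) w s a) -
          M.omc (n + 1) y s a)| := abs_sum_le_sum_abs _ _
    _ ≤ ∑ a, |pol s a - detPolicy f s a| * (1 / (1 - M.γ)) := by
        refine sum_le_sum fun a _ => ?_
        rw [abs_mul]
        refine mul_le_mul ?_ (hd a) (abs_nonneg _) (abs_nonneg _)
        split_ifs
        · exact le_rfl
        · rw [abs_zero]; exact abs_nonneg _
    _ ≤ _ := by
        rw [← sum_mul]
        exact mul_le_mul_of_nonneg_right (sum_abs_sub_detPolicy_le hpol f s) hH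

theorem MDP.trajExp_samplingError {pol : S → A → ℝ} (hpol : IsPolicy pol) (τ : ℝ) (n : ℕ)
    (f : S → A) (s : S) (z : S × A) :
    trajExp (M.pairChain pol) n z (M.samplingError τ n f s pol) = 0 := by
  have hk := M.isKernel_pairChain hpol
  have e : trajExp (M.pairChain pol) n z (M.samplingError τ n f s pol) =
      trajExp (M.pairChain pol) n z fun y => ∑ a,
        (if τ ≤ pol s a then pol s a - detPolicy f s a else 0) *
          (trajExp (M.pairChain pol) n z (fun w => M.omc (n + 1) w s a) +
            (-1) * M.omc (n + 1) y s a) := by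
    refine trajExp_congr n z fun y hy => sum_congr rfl fun a _ => ?_
    rw [hy]; ring
  rw [e, trajExp_sum]
  refine sum_eq_zero fun a _ => ?_
  rw [trajExp_const_mul, trajExp_add, trajExp_const hk, trajExp_const_mul]
  ring

theorem MDP.samplingError_congr (τ : ℝ) (n : ℕ) (f : S → A) (s : S) (pol : S → A → ℝ)
    {x y : ℕ → S × A} (h : ∀ l < n + 1, x l = y l) :
    M.samplingError τ n f s pol x = M.samplingError τ n f s pol y := by
  simp only [MDP.samplingError, h 0 (Nat.succ_pos n), M.omc_congr h]

variable {M} [Nonempty A] {k n : ℕ} {η τ : ℝ} {Ω : Type*} [MeasurableSpace Ω] {ℙ : Measure Ω}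
  [IsProbabilityMeasure ℙ] {ξ : ℕ → ℕ → Ω → S × A} {pol : (ℕ → ℕ → S × A) → ℕ → S → A → ℝ}

theorem MDP.IsRun.dependsOn_sum_samplingError (hrun : M.IsRun k (n + 1) η τ ℙ ξ pol)
    (f : S → A) (s : S) {T : ℕ} (hT : T ≤ k) :
    DependsOnCells (pastCells T (n + 1) 0) fun h =>
      ∑ t ∈ range T, M.samplingError τ n f s (pol h t) (h t) := by
  intro h h' hh
  have hh' : ∀ i < T, ∀ l < n + 1, h i l = h' i l := fun i hi l hl =>
    hh (i, l) (mem_pastCells.2 (Or.inl ⟨hi, hl⟩))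
  refine sum_congr rfl fun t ht => ?_
  have ht' := mem_range.1 ht
  rw [hrun.pol_congr (ht'.le.trans hT) fun i hi => hh' i (hi.trans ht'),
    M.samplingError_congr τ n f s _ (hh' t ht')]

/-- Given the earlier rows and its first pair, the last trajectory has a centred error, so
Hoeffding's lemma costs one more factor `b`. Centring at the exact finite-length mean keeps mixing
out of this bound. -/
theorem MDP.IsRun.integral_exp_samplingError_le (hrun : M.IsRun k (n + 1) η τ ℙ ξ pol)
    (f : S → A) (s : S) (θ : ℝ) {T : ℕ} (hT : T ≤ k) :
    ∫ ω, (fun h => Real.exp (θ * ∑ t ∈ range T, M.samplingError τ n f s (pol h t) (h t)))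
        (fun i j => ξ i j ω) ∂ℙ ≤
      Real.exp (T * ((θ * (2 * (1 / (1 - M.γ)))) ^ 2 / 2)) := by
  obtain ⟨z₀⟩ := MDP.IsRun.nonempty (ℙ := ℙ) ξ
  have : Nonempty (S × A) := ⟨z₀⟩
  induction T with
  | zero => simp
  | succ T ih =>
    have hTk : T < k := hT
    set b := Real.exp ((θ * (2 * (1 / (1 - M.γ)))) ^ 2 / 2) with hb
    set F : (ℕ → ℕ → S × A) → ℝ := fun h =>
      Real.exp (θ * ∑ t ∈ range T, M.samplingError τ n f s (pol h t) (h t)) with hF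
    have hFdep : DependsOnCells (pastCells T (n + 1) 0) F := fun h h' hh => by
      rw [hF]
      simp only [hrun.dependsOn_sum_samplingError f s hTk.le h h' hh]
    have hgdep : DependsOnCells (pastCells T (n + 1) (n + 1)) fun h : ℕ → ℕ → S × A =>
        F h * Real.exp (θ * M.samplingError τ n f s (pol h T) (h T)) := by
      intro h h' hh
      have h1 : F h = F h' := hFdep h h' fun p hp => hh p <| by
        obtain ⟨i, l⟩ := p
        rw [mem_pastCells] at hp ⊢
        omega
      have h2 : pol h T = pol h' T := hrun.pol_congr hTk.le fun i hi l hl =>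
        hh (i, l) (mem_pastCells.2 (Or.inl ⟨hi, hl⟩))
      have h3 : M.samplingError τ n f s (pol h' T) (h T) =
          M.samplingError τ n f s (pol h' T) (h' T) :=
        M.samplingError_congr τ n f s _ fun l hl =>
          hh (T, l) (mem_pastCells.2 (Or.inr ⟨rfl, hl⟩))
      simp only [h1, h2, h3]
    have hpt : ∀ h : ℕ → ℕ → S × A, trajExp (M.pairChain (pol h T)) n (h T 0) (fun y =>
        F (Function.update h T y) * Real.exp (θ * M.samplingError τ n f s
          (pol (Function.update h T y) T) (Function.update h T y T))) ≤ b * F h := by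
      intro h
      have hpol := (hrun.spmd h).isPolicy hTk.le
      have hFu : ∀ y, F (Function.update h T y) = F h := fun y =>
        hFdep _ _ fun p hp => by
          obtain ⟨i, l⟩ := p
          have hi : i ≠ T := by rw [mem_pastCells] at hp; omega
          simp only [Function.update_of_ne hi]
      have hpu : ∀ y, pol (Function.update h T y) T = pol h T := fun y =>
        hrun.pol_congr hTk.le fun i hi l _ => by rw [Function.update_of_ne hi.ne]
      simp only [hFu, hpu, Function.update_self]
      rw [trajExp_const_mul, mul_comm]
      exact mul_le_mul_of_nonneg_right
        (trajExp_exp_le (M.isKernel_pairChain hpol) n (h T 0)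
          (mul_pos two_pos (zero_lt_one.trans_le M.one_le_horizon))
          (M.abs_samplingError_le hpol τ n f s) (M.trajExp_samplingError hpol τ n f s _) θ)
        (Real.exp_pos _).le
    have hstep := hrun.integral_eq_trajExp hTk hgdep
    have hle : ∫ ω, (fun h => trajExp (M.pairChain (pol h T)) n (h T 0) (fun y =>
        F (Function.update h T y) * Real.exp (θ * M.samplingError τ n f s
          (pol (Function.update h T y) T) (Function.update h T y T)))) (fun i j => ξ i j ω) ∂ℙ ≤
        ∫ ω, b * F (fun i j => ξ i j ω) ∂ℙ := by
      have hFint := integrable_comp_data hrun.meas ℙ hFdep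
      refine integral_mono_of_nonneg (Filter.Eventually.of_forall fun ω => ?_)
        (hFint.const_mul b) (Filter.Eventually.of_forall fun ω => hpt _)
      have hpol := (hrun.spmd fun i j => ξ i j ω).isPolicy hTk.le
      rw [Pi.zero_apply, ← trajExp_const (M.isKernel_pairChain hpol) n (ξ T 0 ω) 0]
      exact trajExp_mono (M.isKernel_pairChain hpol) n _ fun y =>
        mul_nonneg (Real.exp_pos _).le (Real.exp_pos _).le
    have e1 : ∀ h : ℕ → ℕ → S × A, Real.exp (θ * ∑ t ∈ range (T + 1),
        M.samplingError τ n f s (pol h t) (h t)) =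
        F h * Real.exp (θ * M.samplingError τ n f s (pol h T) (h T)) := fun h => by
      rw [sum_range_succ, mul_add, Real.exp_add]
    simp only [e1]
    rw [hstep]
    refine hle.trans ?_
    rw [integral_const_mul]
    calc b * _ ≤ b * Real.exp (T * ((θ * (2 * (1 / (1 - M.γ)))) ^ 2 / 2)) :=
          mul_le_mul_of_nonneg_left (ih hTk.le) (Real.exp_pos _).le
      _ = _ := by rw [hb, ← Real.exp_add]; push_cast; ring_nf

theorem MDP.IsRun.measureReal_samplingError_ge_le (hrun : M.IsRun k (n + 1) η τ ℙ ξ pol)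
    (hk : 0 < k) (f : S → A) (s : S) {T : ℕ} (hT : T ≤ k) {r : ℝ} (hr : 0 ≤ r) :
    ℙ.real {ω | 2 * (1 / (1 - M.γ)) * √(2 * k * r) ≤ ∑ t ∈ range T,
        M.samplingError τ n f s (randomPolicy ξ pol t ω) (fun j => ξ t j ω)} ≤
      Real.exp (-r) := by
  obtain ⟨z₀⟩ := MDP.IsRun.nonempty (ℙ := ℙ) ξ
  have : Nonempty (S × A) := ⟨z₀⟩
  set c := 2 * (1 / (1 - M.γ)) with hc
  have hc0 : 0 < c := mul_pos two_pos (zero_lt_one.trans_le M.one_le_horizon)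
  have hk0 : (0 : ℝ) < k := Nat.cast_pos.2 hk
  set q := √(2 * k * r) with hq
  have hq2 : q ^ 2 = 2 * k * r := Real.sq_sqrt (by positivity)
  -- The Chernoff-optimal parameter: `k (θ c)² / 2 = r` and `θ c q = 2 r`.
  set θ := q / (k * c) with hθ
  have hθ0 : 0 ≤ θ := by positivity
  have hint : Integrable (fun ω => Real.exp (θ * ∑ t ∈ range T,
      M.samplingError τ n f s (randomPolicy ξ pol t ω) (fun j => ξ t j ω))) ℙ := by
    refine integrable_comp_data (D := pastCells T (n + 1) 0) hrun.meas ℙ (g := fun h =>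
      Real.exp (θ * ∑ t ∈ range T, M.samplingError τ n f s (pol h t) (h t))) ?_
    intro h h' hh
    simp only [hrun.dependsOn_sum_samplingError f s hT h h' hh]
  refine (ProbabilityTheory.measure_ge_le_exp_mul_mgf (c * q) hθ0 hint).trans ?_
  have h1 := hrun.integral_exp_samplingError_le f s θ hT
  calc _ ≤ Real.exp (-θ * (c * q)) * Real.exp (T * ((θ * c) ^ 2 / 2)) :=
        mul_le_mul_of_nonneg_left h1 (Real.exp_pos _).le
    _ ≤ Real.exp (-r) := by
      rw [← Real.exp_add, Real.exp_le_exp]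
      have h2 : (T : ℝ) * ((θ * c) ^ 2 / 2) ≤ k * ((θ * c) ^ 2 / 2) :=
        mul_le_mul_of_nonneg_right (Nat.cast_le.2 hT) (by positivity)
      have h3 : (k : ℝ) * ((θ * c) ^ 2 / 2) = r := by
        rw [hθ]; field_simp; rw [hq2]; ring
      have h4 : -θ * (c * q) = -(2 * r) := by
        rw [hθ]; field_simp; rw [hq2]; ring
      linarith

/-- Uniform control of the accumulated sampling errors by a union bound. -/
theorem MDP.IsRun.le_measureReal_samplingError (hrun : M.IsRun k (n + 1) η τ ℙ ξ pol)
    (hk : 0 < k) (f : S → A) {δ : ℝ} (hδ : 0 < δ) (hδ1 : δ < 1) [Nonempty S] :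
    1 - δ ≤ ℙ.real {ω | ∀ s, ∀ T ∈ Icc 1 k, ∑ t ∈ range T,
        M.samplingError τ n f s (randomPolicy ξ pol t ω) (fun j => ξ t j ω) ≤
      2 * (1 / (1 - M.γ)) * √(2 * k * Real.log (Fintype.card S * k / δ))} := by
  have hk0 : (0 : ℝ) < k := Nat.cast_pos.2 hk
  have hS0 : (0 : ℝ) < Fintype.card S := Nat.cast_pos.2 Fintype.card_pos
  have harg : 1 ≤ Fintype.card S * k / δ := by
    rw [le_div_iff₀ hδ, one_mul]
    refine hδ1.le.trans ?_
    exact_mod_cast Nat.succ_le_of_lt (Nat.mul_pos (Fintype.card_pos (α := S)) hk)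
  set r := Real.log (Fintype.card S * k / δ) with hr
  have hr0 : 0 ≤ r := Real.log_nonneg harg
  set B : S × ℕ → Set Ω := fun p => {ω | 2 * (1 / (1 - M.γ)) * √(2 * k * r) ≤
    ∑ t ∈ range p.2,
      M.samplingError τ n f p.1 (randomPolicy ξ pol t ω) (fun j => ξ t j ω)} with hB
  set G : Set Ω := {ω | ∀ s, ∀ T ∈ Icc 1 k, ∑ t ∈ range T,
        M.samplingError τ n f s (randomPolicy ξ pol t ω) (fun j => ξ t j ω) ≤
      2 * (1 / (1 - M.γ)) * √(2 * k * r)} with hG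
  have hcover : (Set.univ : Set Ω) ⊆ G ∪ ⋃ p ∈ (univ : Finset S) ×ˢ Icc 1 k, B p := by
    intro ω _
    by_cases h : ω ∈ G
    · exact Or.inl h
    · right
      simp only [hG, Set.mem_ofPred_eq, not_forall, not_le] at h
      obtain ⟨s, T, hT, hlt⟩ := h
      simp only [Set.mem_iUnion]
      exact ⟨(s, T), mem_product.2 ⟨mem_univ s, hT⟩, hlt.le⟩
  -- There are `|S| k` events, each of probability at most `e^{-r} = δ / (|S| k)`. All times are
  -- included because the induction that excludes truncation uses every partial sum.
  have hbad : ℙ.real (⋃ p ∈ (univ : Finset S) ×ˢ Icc 1 k, B p) ≤ δ := by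
    refine (measureReal_biUnion_finset_le _ _).trans ?_
    calc _ ≤ ∑ p ∈ (univ : Finset S) ×ˢ Icc 1 k, Real.exp (-r) := sum_le_sum fun p hp =>
          hrun.measureReal_samplingError_ge_le hk f p.1 (mem_Icc.1 (mem_product.1 hp).2).2 hr0
      _ = δ := by
        rw [sum_const, card_product, Nat.card_Icc, card_univ, Real.exp_neg, hr,
          Real.exp_log (by positivity), nsmul_eq_mul]
        push_cast [Nat.add_sub_cancel]
        field_simp
  have h1 : (1 : ℝ) ≤ ℙ.real (G ∪ ⋃ p ∈ (univ : Finset S) ×ˢ Icc 1 k, B p) := by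
    rw [← probReal_univ (μ := ℙ)]
    exact measureReal_mono hcover
  have h2 := measureReal_union_le (μ := ℙ) G (⋃ p ∈ (univ : Finset S) ×ˢ Icc 1 k, B p)
  linarith

end Concentration

end SPMD

namespace SPMD

open Finset MeasureTheory

/-! ### Regret analysis and absence of truncation along `f`. -/

section Convergence

variable {S A : Type*} [Fintype S] [Fintype A] [DecidableEq S] [DecidableEq A] {M : MDP S A}

theorem MDP.sum_sub_tomc_le {pol : S → A → ℝ} (hpol : IsPolicy pol) {n : ℕ} {τ β : ℝ}
    (hβ0 : 0 ≤ β) {f : S → A} {s : S} (hf : τ ≤ pol s (f s)) (y : ℕ → S × A)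
    (hβ : ∀ a, τ ≤ pol s a → 0 ≤ M.qval pol s a -
        trajExp (M.pairChain pol) n (y 0) (fun w => M.omc (n + 1) w s a) ∧
      M.qval pol s a - trajExp (M.pairChain pol) n (y 0) (fun w => M.omc (n + 1) w s a) ≤ β) :
    (∑ a, pol s a * M.qval pol s a - M.qval pol s (f s)) -
        (∑ a, M.tomc (n + 1) τ pol y s a * pol s a - M.tomc (n + 1) τ pol y s (f s)) ≤
      M.samplingError τ n f s pol y + β := by
  have e : (∑ a, pol s a * M.qval pol s a - M.qval pol s (f s)) -
      (∑ a, M.tomc (n + 1) τ pol y s a * pol s a - M.tomc (n + 1) τ pol y s (f s)) =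
      ∑ a, (pol s a - detPolicy f s a) * (M.qval pol s a - M.tomc (n + 1) τ pol y s a) := by
    rw [← sum_detPolicy_mul f s (M.qval pol s), ← sum_detPolicy_mul f s (M.tomc (n + 1) τ pol y s),
      ← sum_sub_distrib, ← sum_sub_distrib, ← sum_sub_distrib]
    exact sum_congr rfl fun a _ => by ring
  have e2 : M.samplingError τ n f s pol y + β = ∑ a,
      ((if τ ≤ pol s a then pol s a - detPolicy f s a else 0) *
        (trajExp (M.pairChain pol) n (y 0) (fun w => M.omc (n + 1) w s a) -
          M.omc (n + 1) y s a) + pol s a * β) := by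
    rw [sum_add_distrib, ← sum_mul, (hpol s).2, one_mul]; rfl
  rw [e, e2]
  refine sum_le_sum fun a _ => ?_
  have hp := (hpol s).1 a
  unfold MDP.tomc
  split_ifs with h
  -- The bias lies in `[0, β]`: weighted by the policy it costs at most `pol s a * β`, and weighted
  -- by minus the comparator it only helps.
  · obtain ⟨h1, h2⟩ := hβ a h
    have h3 := (isPolicy_detPolicy f s).1 a
    nlinarith [mul_nonneg hp (sub_nonneg.2 h2), mul_nonneg h3 h1]
  -- A truncated action is not the comparator's, so its weight is nonnegative while `Q - 1 / (1 - γ)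
  -- ≤ 0`.
  · have hne : a ≠ f s := fun e => h (e ▸ hf)
    rw [detPolicy, if_neg hne, sub_zero, zero_mul, zero_add]
    have h1 := M.qval_le hpol s a
    nlinarith [mul_nonneg hp (sub_nonneg.2 h1), mul_nonneg hp hβ0]

variable [Nonempty A] {k n : ℕ} {η τ β N : ℝ} {data : ℕ → ℕ → S × A} {pol : ℕ → S → A → ℝ}
  {f : S → A}

/-- The basic inequality of mirror descent, summed over the states. -/
theorem MDP.IsSPMD.sum_occ_neg_log_add_le (h : M.IsSPMD k (n + 1) η τ data pol) (hη : 0 ≤ η)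
    (hβ0 : 0 ≤ β)
    (hβ : ∀ i < k, ∀ s a, τ ≤ pol i s a → ∀ z, 0 ≤ M.qval (pol i) s a -
        trajExp (M.pairChain (pol i)) n z (fun w => M.omc (n + 1) w s a) ∧
      M.qval (pol i) s a -
        trajExp (M.pairChain (pol i)) n z (fun w => M.omc (n + 1) w s a) ≤ β)
    {T : ℕ} (hT : T ≤ k) (hf : ∀ i < T, ∀ s, τ ≤ pol i s (f s))
    (hN : ∀ s, ∑ i ∈ range T, M.samplingError τ n f s (pol i) (data i) ≤ N) (s₀ : S) :
    ∑ s, M.occ (detPolicy f) s₀ s * -Real.log (pol T s (f s)) +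
        η * ∑ i ∈ range T, (M.value (pol i) s₀ - M.value (detPolicy f) s₀) ≤
      1 / (1 - M.γ) * (Real.log (Fintype.card A) + T * (η ^ 2 * (1 / (1 - M.γ)) ^ 2 / 2) +
        η * (N + T * β)) := by
  have hfp := isPolicy_detPolicy f
  set R := Real.log (Fintype.card A) + T * (η ^ 2 * (1 / (1 - M.γ)) ^ 2 / 2) +
        η * (N + T * β) with hR
  set adv : ℕ → S → ℝ := fun i s =>
    ∑ a, pol i s a * M.qval (pol i) s a - M.qval (pol i) s (f s) with hadv
  have hs : ∀ s, -Real.log (pol T s (f s)) + η * ∑ i ∈ range T, adv i s ≤ R := by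
    intro s
    have h1 := h.log_ge hη hT s (f s)
    rw [sum_sub_distrib, sum_const, card_range, nsmul_eq_mul, ← mul_sum] at h1
    have h2 : ∑ i ∈ range T, adv i s ≤ ∑ i ∈ range T,
        (∑ b, M.tomc (n + 1) τ (pol i) (data i) s b * pol i s b -
          M.tomc (n + 1) τ (pol i) (data i) s (f s)) + (N + T * β) := by
      have h3 : ∑ i ∈ range T, adv i s ≤ ∑ i ∈ range T,
          ((∑ b, M.tomc (n + 1) τ (pol i) (data i) s b * pol i s b -
            M.tomc (n + 1) τ (pol i) (data i) s (f s)) +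
              (M.samplingError τ n f s (pol i) (data i) + β)) := by
        refine sum_le_sum fun i hi => ?_
        have hi' := mem_range.1 hi
        have h4 := MDP.sum_sub_tomc_le (M := M) (h.isPolicy (hi'.le.trans hT)) hβ0 (hf i hi' s)
          (data i) fun a ha => hβ i (hi'.trans_le hT) s a ha _
        simp only [hadv]
        linarith
      rw [sum_add_distrib, sum_add_distrib, sum_const, card_range, nsmul_eq_mul] at h3
      linarith [hN s]
    have h5 := mul_le_mul_of_nonneg_left h2 hη
    rw [mul_add] at h5
    linarith
  have h6 : ∑ i ∈ range T, (M.value (pol i) s₀ - M.value (detPolicy f) s₀) =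
      ∑ s, M.occ (detPolicy f) s₀ s * ∑ i ∈ range T, adv i s := by
    simp only [mul_sum]
    rw [sum_comm]
    refine sum_congr rfl fun i hi => ?_
    rw [← M.sum_occ_mul_advantage (h.isPolicy ((mem_range.1 hi).le.trans hT)) hfp]
    simp only [sum_detPolicy_mul, hadv]
  rw [h6, ← M.sum_occ hfp s₀, mul_sum, sum_mul, ← sum_add_distrib]
  refine sum_le_sum fun s _ => ?_
  calc _ = M.occ (detPolicy f) s₀ s * (-Real.log (pol T s (f s)) + η * ∑ i ∈ range T, adv i s) := by
        ring
    _ ≤ _ := mul_le_mul_of_nonneg_left (hs s) (M.occ_nonneg hfp s₀ s)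

/-- The optimal actions are never truncated. -/
theorem MDP.IsSPMD.threshold_le (h : M.IsSPMD k (n + 1) η τ data pol) (hη : 0 ≤ η)
    (hβ0 : 0 ≤ β) (hN0 : 0 ≤ N) {Z : ℝ} (hτ : τ = threshold (Fintype.card A) M.γ Z)
    (hβ : ∀ i < k, ∀ s a, τ ≤ pol i s a → ∀ z, 0 ≤ M.qval (pol i) s a -
        trajExp (M.pairChain (pol i)) n z (fun w => M.omc (n + 1) w s a) ∧
      M.qval (pol i) s a -
        trajExp (M.pairChain (pol i)) n z (fun w => M.omc (n + 1) w s a) ≤ β)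
    (hopt : ∀ pol', IsPolicy pol' → ∀ s, M.value (detPolicy f) s ≤ M.value pol' s)
    (hN : ∀ s, ∀ T ∈ Icc 1 k, ∑ i ∈ range T, M.samplingError τ n f s (pol i) (data i) ≤ N)
    (hR : Real.log (Fintype.card A) + k * (η ^ 2 * (1 / (1 - M.γ)) ^ 2 / 2) +
        η * (N + k * β) ≤ (2 + Z) * Real.log (Fintype.card A))
    {T : ℕ} (hT : T ≤ k) (s : S) : τ ≤ pol T s (f s) := by
  have hfp := isPolicy_detPolicy f
  -- The inequality at time `T` needs the comparator untruncated only at times before `T`, at all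
  -- states, hence strong induction.
  induction T using Nat.strong_induction_on generalizing s with
  | _ T ih =>
    have hNT : ∀ s, ∑ i ∈ range T, M.samplingError τ n f s (pol i) (data i) ≤ N := by
      intro s
      rcases Nat.eq_zero_or_pos T with rfl | hpos
      · simpa using hN0
      · exact hN s T (mem_Icc.2 ⟨hpos, hT⟩)
    have h1 := h.sum_occ_neg_log_add_le hη hβ0 hβ hT
      (fun i hi s => ih i hi (hi.le.trans hT) s) hNT s
    have hlog : ∀ s, 0 ≤ -Real.log (pol T s (f s)) := by
      intro s
      have hp := h.isPolicy hT s
      have hle : pol T s (f s) ≤ 1 := by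
        rw [← hp.2]
        exact single_le_sum (fun a _ => hp.1 a) (mem_univ _)
      exact neg_nonneg.2 (Real.log_nonpos (h.pos hT s _).le hle)
    -- All terms are nonnegative and the occupancy of the initial state is at least 1, so a single
    -- state is bounded by the weighted sum.
    have h2 : -Real.log (pol T s (f s)) ≤
        ∑ s', M.occ (detPolicy f) s s' * -Real.log (pol T s' (f s')) := by
      refine le_trans ?_ (single_le_sum (f := fun s' => M.occ (detPolicy f) s s' *
        -Real.log (pol T s' (f s'))) (fun s' _ => mul_nonneg (M.occ_nonneg hfp s s') (hlog s'))
        (mem_univ s))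
      exact le_mul_of_one_le_left (hlog s) (M.one_le_occ_self hfp s)
    have h3 : 0 ≤ η * ∑ i ∈ range T, (M.value (pol i) s - M.value (detPolicy f) s) :=
      mul_nonneg hη (sum_nonneg fun i hi =>
        sub_nonneg.2 (hopt _ (h.isPolicy ((mem_range.1 hi).le.trans hT)) s))
    have hTk : (T : ℝ) ≤ k := Nat.cast_le.2 hT
    have h4 : Real.log (Fintype.card A) + T * (η ^ 2 * (1 / (1 - M.γ)) ^ 2 / 2) +
        η * (N + T * β) ≤ (2 + Z) * Real.log (Fintype.card A) := by
      refine le_trans ?_ hR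
      have h5 : (T : ℝ) * (η ^ 2 * (1 / (1 - M.γ)) ^ 2 / 2) ≤
          k * (η ^ 2 * (1 / (1 - M.γ)) ^ 2 / 2) := mul_le_mul_of_nonneg_right hTk (by positivity)
      have h6 : η * (N + T * β) ≤ η * (N + k * β) := mul_le_mul_of_nonneg_left
        (by linarith [mul_le_mul_of_nonneg_right hTk hβ0]) hη
      linarith
    have h7 := mul_le_mul_of_nonneg_left h4 (zero_le_one.trans M.one_le_horizon)
    have h8 : -(1 / (1 - M.γ) * ((2 + Z) * Real.log (Fintype.card A))) ≤
        Real.log (pol T s (f s)) := by linarith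
    rw [hτ, threshold, Real.rpow_def_of_pos (Nat.cast_pos.2 Fintype.card_pos)]
    refine le_trans (Real.exp_le_exp.2 (le_of_eq_of_le ?_ h8)) (Real.exp_log (h.pos hT s _)).le
    ring

/-- The logarithmic terms are nonnegative and dropped; the best gap is at most the average gap.
Linearity in `θ` gives all initial laws at once. -/
theorem MDP.IsSPMD.bestGap_le (h : M.IsSPMD k (n + 1) η τ data pol) (hη : 0 < η) (hk : 0 < k)
    (hβ0 : 0 ≤ β)
    (hβ : ∀ i < k, ∀ s a, τ ≤ pol i s a → ∀ z, 0 ≤ M.qval (pol i) s a -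
        trajExp (M.pairChain (pol i)) n z (fun w => M.omc (n + 1) w s a) ∧
      M.qval (pol i) s a -
        trajExp (M.pairChain (pol i)) n z (fun w => M.omc (n + 1) w s a) ≤ β)
    (hf : ∀ i < k, ∀ s, τ ≤ pol i s (f s))
    (hN : ∀ s, ∑ i ∈ range k, M.samplingError τ n f s (pol i) (data i) ≤ N)
    {θ : S → ℝ} (hθ : θ ∈ stdSimplex ℝ S) {polStar : S → A → ℝ}
    (hstar : ∀ s, M.value (detPolicy f) s = M.value polStar s) :
    M.bestGap k θ pol polStar ≤
      1 / (1 - M.γ) * (Real.log (Fintype.card A) + k * (η ^ 2 * (1 / (1 - M.γ)) ^ 2 / 2) +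
        η * (N + k * β)) / (η * k) := by
  have hk0 : (0 : ℝ) < k := Nat.cast_pos.2 hk
  set R := 1 / (1 - M.γ) * (Real.log (Fintype.card A) + k * (η ^ 2 * (1 / (1 - M.γ)) ^ 2 / 2) +
        η * (N + k * β)) with hR
  have hs : ∀ s, η * ∑ i ∈ range k, (M.value (pol i) s - M.value polStar s) ≤ R := by
    intro s
    have h1 := h.sum_occ_neg_log_add_le hη.le hβ0 hβ le_rfl hf hN s
    have h2 : 0 ≤ ∑ s', M.occ (detPolicy f) s s' * -Real.log (pol k s' (f s')) := by
      refine sum_nonneg fun s' _ => mul_nonneg (M.occ_nonneg (isPolicy_detPolicy f) s s') ?_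
      have hp := h.isPolicy le_rfl s'
      have hle : pol k s' (f s') ≤ 1 := by
        rw [← hp.2]
        exact single_le_sum (fun a _ => hp.1 a) (mem_univ _)
      exact neg_nonneg.2 (Real.log_nonpos (h.pos le_rfl s' _).le hle)
    rw [hstar s] at h1
    linarith
  have hmean : ∑ s, θ s * (η * ∑ i ∈ range k, (M.value (pol i) s - M.value polStar s)) ≤ R := by
    calc _ ≤ ∑ s, θ s * R := sum_le_sum fun s _ => mul_le_mul_of_nonneg_left (hs s) (hθ.1 s)
      _ = R := by rw [← sum_mul, hθ.2, one_mul]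
  have e : ∑ s, θ s * (η * ∑ i ∈ range k, (M.value (pol i) s - M.value polStar s)) =
      η * ∑ i ∈ range k, (M.objective θ (pol i) - M.objective θ polStar) := by
    simp only [MDP.objective, ← sum_sub_distrib, mul_sum]
    rw [sum_comm]
    exact sum_congr rfl fun i _ => sum_congr rfl fun s _ => by ring
  have hbest : (k : ℝ) * M.bestGap k θ pol polStar ≤
      ∑ i ∈ range k, (M.objective θ (pol i) - M.objective θ polStar) := by
    have h1 := card_nsmul_le_sum (range k)
      (fun i => M.objective θ (pol i) - M.objective θ polStar) (M.bestGap k θ pol polStar)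
      fun i hi => sub_le_sub_right (ciInf_le (f := fun t : Fin k => M.objective θ (pol t))
        (Set.finite_range _).bddBelow ⟨i, mem_range.1 hi⟩) _
    rwa [card_range, nsmul_eq_mul] at h1
  rw [le_div_iff₀ (mul_pos hη hk0)]
  rw [e] at hmean
  have := mul_le_mul_of_nonneg_left hbest hη.le
  linarith

theorem MDP.objective_nonneg {pol : S → A → ℝ} (hpol : IsPolicy pol) {θ : S → ℝ}
    (hθ : θ ∈ stdSimplex ℝ S) : 0 ≤ M.objective θ pol :=
  sum_nonneg fun s _ => mul_nonneg (hθ.1 s) (M.value_nonneg hpol s)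

theorem MDP.bestGap_le_horizon (hk : 0 < k) {θ : S → ℝ} (hθ : θ ∈ stdSimplex ℝ S)
    (hpol : IsPolicy (pol 0)) {polStar : S → A → ℝ} (hstar : IsPolicy polStar) :
    M.bestGap k θ pol polStar ≤ 1 / (1 - M.γ) := by
  have h1 := ciInf_le (f := fun t : Fin k => M.objective θ (pol t))
        (Set.finite_range _).bddBelow ⟨0, hk⟩
  have h2 : M.objective θ (pol 0) ≤ 1 / (1 - M.γ) :=
    (sum_mul_mem_Icc hθ fun s => ⟨M.value_nonneg hpol s, M.value_le hpol s⟩).2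
  have h3 := M.objective_nonneg hstar hθ
  unfold MDP.bestGap
  simp only at h1
  linarith

end Convergence

end SPMD

namespace SPMD

open Finset MeasureTheory

/-! ### Inequalities between the prescribed parameters. -/

section Parameters

variable {nS nA k : ℕ} {γ δ : ℝ}

theorem log_card_pos (hA : 2 ≤ nA) : 0 < Real.log nA :=
  Real.log_pos (by exact_mod_cast hA)

theorem zetaStar_pos (hA : 2 ≤ nA) (hγ : γ < 1) : 0 < zetaStar nA γ := by
  have h := log_card_pos hA
  have hg : 0 < 1 - γ := sub_pos.2 hγ
  exact lt_min (Real.sqrt_pos.2 (by positivity)) h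

theorem zetaStar_le_log : zetaStar nA γ ≤ Real.log nA := min_le_right _ _

theorem zetaStar_sq_mul_le (hA : 2 ≤ nA) (hγ : γ < 1) :
    zetaStar nA γ ^ 2 * (1 / (1 - γ)) ^ 2 ≤ 2 * Real.log nA := by
  have h := log_card_pos hA
  have hg : 0 < 1 - γ := sub_pos.2 hγ
  have h1 : zetaStar nA γ ≤ √(2 * Real.log nA * (1 - γ) ^ 2) := min_le_left _ _
  have h2 := pow_le_pow_left₀ (zetaStar_pos hA hγ).le h1 2
  rw [Real.sq_sqrt (by positivity)] at h2
  calc _ ≤ 2 * Real.log nA * (1 - γ) ^ 2 * (1 / (1 - γ)) ^ 2 :=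
        mul_le_mul_of_nonneg_right h2 (by positivity)
    _ = 2 * Real.log nA := by field_simp

theorem stepsize_eq : stepsize nA k γ = zetaStar nA γ / √k := by
  rw [stepsize, zetaStar, one_div, inv_pow, div_inv_eq_mul]

theorem one_lt_union_factor (hS : 1 ≤ nS) (hk : 0 < k) (hδ : 0 < δ) (hδ1 : δ < 1) :
    1 < nS * k / δ := by
  rw [lt_div_iff₀ hδ, one_mul]
  refine hδ1.trans_le ?_
  exact_mod_cast Nat.succ_le_of_lt (Nat.mul_pos hS hk)

theorem noiseZ_nonneg (hγ : γ < 1) : 0 ≤ noiseZ nS k γ δ := by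
  have hg : 0 < 1 - γ := sub_pos.2 hγ
  unfold noiseZ
  positivity

theorem threshold_pos (hA : 2 ≤ nA) (Z : ℝ) : 0 < threshold nA γ Z :=
  Real.rpow_pos_of_pos (by positivity) _

theorem threshold_le_one (hA : 2 ≤ nA) (hγ : γ < 1) {Z : ℝ} (hZ : 0 ≤ Z) :
    threshold nA γ Z ≤ 1 := by
  refine Real.rpow_le_one_of_one_le_of_nonpos (by exact_mod_cast (by omega : 1 ≤ nA)) ?_
  exact div_nonpos_of_nonpos_of_nonneg (by linarith) (by linarith)

/-- In units of `√(r k) / (1 - γ)`, the deviation takes `2√2 ≤ 3` and the total bias `k ε / 2` takes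
`1`; this accounts for the 4 in `Z`. -/
theorem noise_budget (hk : 0 < k) (hγ : γ < 1) {r : ℝ} (hr : 0 ≤ r) :
    2 * (1 / (1 - γ)) * √(2 * k * r) + k * (2 / (1 - γ) * √(r / k) / 2) ≤
      4 * √r / (1 - γ) * √k := by
  have hg : 0 < 1 - γ := sub_pos.2 hγ
  have hk0 : (0 : ℝ) < k := Nat.cast_pos.2 hk
  have hy := Real.sqrt_pos.2 hk0
  have hk2 : (√k : ℝ) ^ 2 = k := Real.sq_sqrt hk0.le
  rw [Real.sqrt_div hr, Real.sqrt_mul (by positivity), Real.sqrt_mul (by norm_num)]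
  have h2 : √2 ≤ 3 / 2 := Real.sqrt_le_iff.2 (by norm_num)
  have e : (k : ℝ) * (2 / (1 - γ) * (√r / √k) / 2) = √r * √k / (1 - γ) := by
    nth_rewrite 1 [← hk2]
    field_simp
  rw [e]
  have h3 : 0 ≤ √r * √k / (1 - γ) := by positivity
  have h4 := mul_le_mul_of_nonneg_right h2 h3
  calc _ = 2 * (√2 * (√r * √k / (1 - γ))) + √r * √k / (1 - γ) := by ring
    _ ≤ 4 * (√r * √k / (1 - γ)) := by linarith
    _ = _ := by ring

/-- The two entries of the minimum in the stepsize cap the quadratic term by `log |A|` and the noise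
by `Z log |A|`; with the initial `log |A|` this makes `2 + Z`. -/
theorem exploration_budget (hA : 2 ≤ nA) (hk : 0 < k) (hγ : γ < 1) {Z X : ℝ} (hZ : 0 ≤ Z)
    (hX : X ≤ Z * √k) :
    Real.log nA + k * (stepsize nA k γ ^ 2 * (1 / (1 - γ)) ^ 2 / 2) + stepsize nA k γ * X ≤
      (2 + Z) * Real.log nA := by
  have hk0 : (0 : ℝ) < k := Nat.cast_pos.2 hk
  have hy := Real.sqrt_pos.2 hk0
  have hk2 : (√k : ℝ) ^ 2 = k := Real.sq_sqrt hk0.le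
  have hζ := zetaStar_pos hA hγ
  have h1 := zetaStar_sq_mul_le hA hγ
  rw [stepsize_eq]
  have e : (k : ℝ) * ((zetaStar nA γ / √k) ^ 2 * (1 / (1 - γ)) ^ 2 / 2) =
      zetaStar nA γ ^ 2 * (1 / (1 - γ)) ^ 2 / 2 := by
    rw [div_pow, hk2]; field_simp
  have h2 : zetaStar nA γ / √k * X ≤ zetaStar nA γ * Z := by
    calc _ ≤ zetaStar nA γ / √k * (Z * √k) := mul_le_mul_of_nonneg_left hX (by positivity)
      _ = _ := by field_simp
  have h3 := mul_le_mul_of_nonneg_right (zetaStar_le_log (nA := nA) (γ := γ)) hZ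
  rw [e]
  linarith

theorem regret_bound_le_gapBound (hA : 2 ≤ nA) (hk : 0 < k) (hγ : γ < 1) {Z X : ℝ}
    (hX : X ≤ Z * √k) :
    1 / (1 - γ) * (Real.log nA + k * (stepsize nA k γ ^ 2 * (1 / (1 - γ)) ^ 2 / 2) +
      stepsize nA k γ * X) / (stepsize nA k γ * k) ≤ gapBound nA k γ Z := by
  have hg : 0 < 1 - γ := sub_pos.2 hγ
  have hk0 : (0 : ℝ) < k := Nat.cast_pos.2 hk
  have hy := Real.sqrt_pos.2 hk0
  have hk2 : (√k : ℝ) ^ 2 = k := Real.sq_sqrt hk0.le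
  have hζ := zetaStar_pos hA hγ
  rw [stepsize_eq]
  calc _ ≤ 1 / (1 - γ) * (Real.log nA + k * ((zetaStar nA γ / √k) ^ 2 * (1 / (1 - γ)) ^ 2 / 2) +
      zetaStar nA γ / √k * (Z * √k)) / (zetaStar nA γ / √k * k) := by gcongr
    _ = gapBound nA k γ Z := by
      unfold gapBound
      rw [← hk2, Real.sqrt_sq hy.le]
      field_simp

/-- The noise term alone equals `2 ε / (1 - γ)`. For large `ε` the claim is thus trivial, which
matters because `log (|A| / ε)` may then be negative and the length condition void. -/
theorem horizon_le_gapBound (hA : 2 ≤ nA) (hγ : γ < 1)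
    (hε : 1 / 2 ≤ biasLevel nS k γ δ) :
    1 / (1 - γ) ≤ gapBound nA k γ (noiseZ nS k γ δ) := by
  have hg : 0 < 1 - γ := sub_pos.2 hγ
  have hζ := zetaStar_pos hA hγ
  have hl := log_card_pos hA
  have e : noiseZ nS k γ δ / ((1 - γ) * √k) = 2 * biasLevel nS k γ δ / (1 - γ) := by
    rw [noiseZ, biasLevel, Real.sqrt_div' _ (Nat.cast_nonneg k)]
    field_simp
    ring
  have h1 : 1 / (1 - γ) ≤ noiseZ nS k γ δ / ((1 - γ) * √k) := by
    rw [e]; gcongr; linarith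
  have h2 : 0 ≤ Real.log nA / (zetaStar nA γ * (1 - γ) * √k) := by positivity
  have h3 : 0 ≤ zetaStar nA γ * (1 / (1 - γ)) ^ 2 / (2 * (1 - γ) * √k) := by positivity
  unfold gapBound
  linarith

theorem horizon_le_lengthScale {C ρ νmin τ : ℝ} (hν : 0 < νmin) (hτ : 0 < τ) :
    1 / (1 - γ) ≤ lengthScale γ C ρ νmin τ := by
  refine le_add_of_nonneg_right (div_nonneg ?_ (mul_pos hν hτ).le)
  exact_mod_cast zero_le_one.trans (le_max_left (1 : ℤ) _)

/-- The rate `l = log (4 / ((1 - γ) ε))` makes the bias `2 e^{-l} / (1 - γ)` equal to `ε / 2`. Its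
part `log (1 / (1 - γ)) ≤ log L` is what the factor `1 + log L` pays for. -/
theorem length_of_trajLength_le {C ρ νmin τ ε x : ℝ} (hA : 2 ≤ nA) (hγ0 : 0 < γ) (hγ : γ < 1)
    (hν : 0 < νmin) (hτ : 0 < τ) (hε0 : 0 < ε) (hε : ε ≤ 1 / 2)
    (hx : trajLength 6 1 nA γ C ρ νmin τ ε ≤ x) :
    1 ≤ Real.log (4 * (1 / (1 - γ)) / ε) ∧
      3 * Real.log (4 * (1 / (1 - γ)) / ε) * lengthScale γ C ρ νmin τ ≤ x := by
  have hg : 0 < 1 - γ := sub_pos.2 hγ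
  have hH : 1 ≤ 1 / (1 - γ) := by rw [le_div_iff₀ hg]; linarith
  have hL := horizon_le_lengthScale (γ := γ) (C := C) (ρ := ρ) hν hτ
  set H := 1 / (1 - γ)
  set L := lengthScale γ C ρ νmin τ with hLdef
  have hL1 : 1 ≤ L := hH.trans hL
  have hA' : (2 : ℝ) ≤ nA := by exact_mod_cast hA
  have h4 : Real.log 4 = 2 * Real.log 2 := by
    rw [show (4 : ℝ) = 2 ^ 2 by norm_num, Real.log_pow]; norm_num
  have hl2 := Real.log_two_gt_d9
  have hie : Real.log 2 ≤ Real.log (1 / ε) := by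
    apply Real.log_le_log two_pos
    rw [le_div_iff₀ hε0]; linarith
  have e1 : Real.log (4 * H / ε) = Real.log 4 + Real.log H + Real.log (1 / ε) := by
    rw [mul_div_assoc, ← mul_one_div H ε, Real.log_mul (by norm_num) (by positivity),
      Real.log_mul (by positivity) (by positivity)]
    ring
  have e2 : Real.log (nA / ε) = Real.log nA + Real.log (1 / ε) := by
    rw [← mul_one_div, Real.log_mul (by positivity) (by positivity)]
  have hlA : Real.log 2 ≤ Real.log nA := Real.log_le_log two_pos hA'
  have hlH0 : 0 ≤ Real.log H := Real.log_nonneg hH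
  have hlHL : Real.log H ≤ Real.log L := Real.log_le_log (by linarith) hL
  refine ⟨by linarith, le_trans ?_ hx⟩
  rw [trajLength, pow_one, ← hLdef, e1, e2]
  have key : Real.log 4 + Real.log H + Real.log (1 / ε) ≤
      2 * ((Real.log nA + Real.log (1 / ε)) * (1 + Real.log L)) := by
    have : Real.log L ≤ (Real.log nA + Real.log (1 / ε)) * Real.log L :=
      le_mul_of_one_le_left (by linarith) (by linarith)
    nlinarith
  have h5 := mul_le_mul_of_nonneg_right key (by linarith : (0 : ℝ) ≤ L)
  linarith

end Parameters

/-! ### The gap bound with high probability. -/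

section HighProbability

variable {S : Type u} {A : Type v} [Fintype S] [Fintype A] [DecidableEq S] [DecidableEq A]
  [Nonempty S] (M : MDP S A)

theorem MDP.highProbGap_gapBound {δ C ρ νmin : ℝ} (hA : 2 ≤ Fintype.card A) (hδ : 0 < δ)
    (hδ1 : δ < 1) (hC : 0 < C) (hρ : 0 < ρ) (hρ1 : ρ < 1) (hν : 0 < νmin) (hν1 : νmin ≤ 1)
    {k n : ℕ} (hk : 0 < k) (hn : 0 < n)
    (hlen : trajLength 6 1 (Fintype.card A) M.γ C ρ νmin
      (threshold (Fintype.card A) M.γ (noiseZ (Fintype.card S) k M.γ δ))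
      (biasLevel (Fintype.card S) k M.γ δ) ≤ n) :
    MDP.HighProbGap.{u, v, w} M k n δ C ρ νmin
      (gapBound (Fintype.card A) k M.γ (noiseZ (Fintype.card S) k M.γ δ)) := by
  intro Ω _ ℙ _ ξ pol hrun hmix
  have : Nonempty A := Fintype.card_pos_iff.1 (by omega)
  obtain ⟨n, rfl⟩ : ∃ m, n = m + 1 := ⟨n - 1, by omega⟩
  have hγ0 := M.γ_pos
  have hγ1 := M.γ_lt_one
  set B := gapBound (Fintype.card A) k M.γ (noiseZ (Fintype.card S) k M.γ δ) with hB
  have htriv : (∀ ω, ∀ θ ∈ stdSimplex ℝ S, ∀ polStar, M.IsOptimal polStar →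
      M.bestGap k θ (fun t => randomPolicy ξ pol t ω) polStar ≤ B) →
      1 - δ ≤ ℙ.real {ω | ∀ θ ∈ stdSimplex ℝ S, ∀ polStar, M.IsOptimal polStar →
        M.bestGap k θ (fun t => randomPolicy ξ pol t ω) polStar ≤ B} := by
    intro h
    rw [show {ω | ∀ θ ∈ stdSimplex ℝ S, ∀ polStar, M.IsOptimal polStar →
        M.bestGap k θ (fun t => randomPolicy ξ pol t ω) polStar ≤ B} = Set.univ from
      Set.eq_univ_of_forall h, probReal_univ]
    linarith
  by_cases hex : ∃ polStar, M.IsOptimal polStar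
  swap
  · exact htriv fun ω θ _ polStar hs => absurd ⟨polStar, hs⟩ hex
  rcases le_or_gt (1 / 2) (biasLevel (Fintype.card S) k M.γ δ) with hε | hε
  · refine htriv fun ω θ hθ polStar hs => ?_
    exact (MDP.bestGap_le_horizon hk hθ ((hrun.spmd _).isPolicy (Nat.zero_le k)) hs.1).trans
      (horizon_le_gapBound hA hγ1 hε)
  obtain ⟨pol₀, hpol₀⟩ := hex
  obtain ⟨f, hfv⟩ := M.exists_detPolicy_value_eq hpol₀
  have hr : 0 < Real.log (Fintype.card S * k / δ) :=
    Real.log_pos (one_lt_union_factor Fintype.card_pos hk hδ hδ1)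
  set Z := noiseZ (Fintype.card S) k M.γ δ with hZ
  set τ := threshold (Fintype.card A) M.γ Z with hτ
  set ε := biasLevel (Fintype.card S) k M.γ δ with hεdef
  have hg := M.one_sub_γ_pos
  have hk0 : (0 : ℝ) < k := Nat.cast_pos.2 hk
  have hε0 : 0 < ε := by
    rw [hεdef, biasLevel]
    exact mul_pos (by positivity) (Real.sqrt_pos.2 (div_pos hr hk0))
  have hZ0 : 0 ≤ Z := noiseZ_nonneg hγ1
  have hτ0 : 0 < τ := threshold_pos hA Z
  have hτ1 : τ ≤ 1 := threshold_le_one hA hγ1 hZ0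
  obtain ⟨hl1, hl2⟩ := length_of_trajLength_le hA hγ0 hγ1 hν hτ0 hε0 hε.le hlen
  have hH := M.one_le_horizon
  have hη : 0 < stepsize (Fintype.card A) k M.γ := by
    rw [stepsize_eq]
    exact div_pos (zetaStar_pos hA hγ1) (Real.sqrt_pos.2 hk0)
  set N := 2 * (1 / (1 - M.γ)) * √(2 * k * Real.log (Fintype.card S * k / δ)) with hN
  have hbudget : N + k * (ε / 2) ≤ Z * √k := noise_budget hk hγ1 hr.le
  refine (hrun.le_measureReal_samplingError hk f hδ hδ1).trans ?_
  -- The mixing assumption holds only almost surely, so the good event is included in the target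
  -- event up to a null set.
  refine ENNReal.toReal_mono (measure_ne_top _ _) (measure_mono_ae ?_)
  filter_upwards [hmix] with ω hω
  intro hG θ hθ polStar hs
  have hspmd := hrun.spmd fun i j => ξ i j ω
  have hβ : ∀ i < k, ∀ s a, τ ≤ randomPolicy ξ pol i ω s a → ∀ z,
      0 ≤ M.qval (randomPolicy ξ pol i ω) s a - trajExp (M.pairChain (randomPolicy ξ pol i ω)) n z
        (fun w => M.omc (n + 1) w s a) ∧
      M.qval (randomPolicy ξ pol i ω) s a - trajExp (M.pairChain (randomPolicy ξ pol i ω)) n z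
        (fun w => M.omc (n + 1) w s a) ≤ ε / 2 := by
    intro i hi s a ha z
    have hpol := hspmd.isPolicy hi.le
    have h1 := M.qval_sub_trajExp_omc hpol (s, a) n z
    refine ⟨h1.1, h1.2.trans ?_⟩
    have h2 := M.missFactor_le_exp hpol (x := (s, a)) (hω i hi.le) hC hρ hρ1 hν hν1 hτ0 hτ1 ha hl1
      hl2 z
    calc _ ≤ 2 * Real.exp (-Real.log (4 * (1 / (1 - M.γ)) / ε)) * (1 / (1 - M.γ)) :=
          mul_le_mul_of_nonneg_right h2 (by positivity)
      _ = ε / 2 := by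
        rw [Real.exp_neg, Real.exp_log (by positivity)]
        field_simp
        norm_num
  have hopt : ∀ pol', IsPolicy pol' → ∀ s, M.value (detPolicy f) s ≤ M.value pol' s :=
    fun pol' hp s => (hfv s).trans_le (hpol₀.2 pol' hp s)
  have hR := exploration_budget hA hk hγ1 hZ0 hbudget
  have hexpl : ∀ i < k, ∀ s, τ ≤ randomPolicy ξ pol i ω s (f s) := fun i hi s =>
    hspmd.threshold_le hη.le (half_pos hε0).le (by positivity) hτ hβ hopt hG hR hi.le s
  -- All optimal policies share their values, so the fixed `f` serves for each of them on the same
  -- event.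
  have hstar : ∀ s, M.value (detPolicy f) s = M.value polStar s := fun s =>
    (hfv s).trans (le_antisymm (hpol₀.2 _ hs.1 s) (hs.2 _ hpol₀.1 s))
  exact (hspmd.bestGap_le hη hk (half_pos hε0).le hβ hexpl
    (fun s => hG s k (mem_Icc.2 ⟨hk, le_rfl⟩)) hθ hstar).trans
    (regret_bound_le_gapBound hA hk hγ1 hbudget)

end HighProbability

end SPMD

namespace SPMD

open Filter Topology

/-! ### Choice of the number of iterations and the total sample count. -/

section SampleComplexity

variable {nS nA k : ℕ} {γ δ : ℝ}

theorem tendsto_gapBound (hS : 1 ≤ nS) (hδ : 0 < δ) :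
    Tendsto (fun k : ℕ => gapBound nA k γ (noiseZ nS k γ δ)) atTop (𝓝 0) := by
  have hS0 : (0 : ℝ) < nS := Nat.cast_pos.2 hS
  have hinv : Tendsto (fun k : ℕ => ((k : ℝ))⁻¹) atTop (𝓝 0) :=
    tendsto_inv_atTop_zero.comp tendsto_natCast_atTop_atTop
  have hs : Tendsto (fun k : ℕ => (√(k : ℝ))⁻¹) atTop (𝓝 0) :=
    tendsto_inv_atTop_zero.comp (Real.tendsto_sqrt_atTop.comp tendsto_natCast_atTop_atTop)
  have hlog : Tendsto (fun k : ℕ => Real.log k / (k : ℝ)) atTop (𝓝 0) :=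
    Real.isLittleO_log_id_atTop.tendsto_div_nhds_zero.comp tendsto_natCast_atTop_atTop
  have hr : Tendsto (fun k : ℕ => √(Real.log (nS * k / δ) / k)) atTop (𝓝 0) := by
    have h1 : Tendsto (fun k : ℕ => Real.log (nS / δ) * (k : ℝ)⁻¹ + Real.log k / (k : ℝ))
        atTop (𝓝 0) := by
      simpa using (hinv.const_mul (Real.log (nS / δ))).add hlog
    have h2 : Tendsto (fun k : ℕ => Real.log (nS * k / δ) / k) atTop (𝓝 0) := by
      refine h1.congr' ?_
      filter_upwards [eventually_gt_atTop 0] with k hk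
      have hk0 : (0 : ℝ) < k := Nat.cast_pos.2 hk
      rw [show (nS * k / δ : ℝ) = nS / δ * k by ring, Real.log_mul (by positivity) hk0.ne']
      ring
    have h3 := (Real.continuous_sqrt.tendsto 0).comp h2
    rwa [Real.sqrt_zero] at h3
  have h := ((hs.const_mul (Real.log nA / (zetaStar nA γ * (1 - γ)))).add
    (hs.const_mul (zetaStar nA γ * (1 / (1 - γ)) ^ 2 / (2 * (1 - γ))))).add
    (hr.const_mul (4 / (1 - γ) ^ 2))
  simp only [mul_zero, add_zero] at h
  refine h.congr fun k => ?_
  rw [gapBound, noiseZ, Real.sqrt_div' _ (Nat.cast_nonneg k)]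
  generalize 1 - γ = g
  ring

theorem noiseZ_mono (hS : 1 ≤ nS) (hδ : 0 < δ) (hγ : γ < 1) {j k : ℕ} (hj : 0 < j)
    (hjk : j ≤ k) : noiseZ nS j γ δ ≤ noiseZ nS k γ δ := by
  have hg : 0 < 1 - γ := sub_pos.2 hγ
  have hS0 : (0 : ℝ) < nS := Nat.cast_pos.2 hS
  have hj0 : (0 : ℝ) < j := Nat.cast_pos.2 hj
  have hjk' : (j : ℝ) ≤ k := Nat.cast_le.2 hjk
  unfold noiseZ
  have : Real.log (nS * j / δ) ≤ Real.log (nS * k / δ) :=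
    Real.log_le_log (by positivity) (by gcongr)
  have := Real.sqrt_le_sqrt this
  gcongr

/-- By AM-GM the last two terms of `W` are at least `2 a b`, in which `ζ*` cancels; `log 2 > 1 / 2`
does the rest. -/
theorem half_le_iterScale (hA : 2 ≤ nA) (hγ0 : 0 < γ) (hγ : γ < 1) (Z : ℝ) {acc : ℝ}
    (hacc : 0 < acc) (hacc1 : acc ≤ 1 / (1 - γ)) :
    1 / 2 ≤ iterScale nA γ Z * (1 / acc ^ 2) := by
  have hg : 0 < 1 - γ := sub_pos.2 hγ
  have hζ := zetaStar_pos hA hγ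
  have hH : 1 ≤ 1 / (1 - γ) := by rw [le_div_iff₀ hg]; linarith
  have hl : Real.log 2 ≤ Real.log nA := Real.log_le_log two_pos (by exact_mod_cast hA)
  have hl2 := Real.log_two_gt_d9
  set a := Real.log nA / (zetaStar nA γ * (1 - γ)) with ha
  set b := zetaStar nA γ * (1 / (1 - γ)) ^ 2 / (2 * (1 - γ)) with hb
  have hab : 2 * a * b = Real.log nA * (1 / (1 - γ)) ^ 4 := by
    rw [ha, hb]; field_simp
  have hW : iterScale nA γ Z = Z ^ 2 / (1 - γ) ^ 2 + b ^ 2 + a ^ 2 := by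
    rw [iterScale, ha, hb]
    generalize 1 - γ = g
    ring
  have h1 : 1 / 2 * (1 / (1 - γ)) ^ 2 ≤ iterScale nA γ Z := by
    have h2 : 0 ≤ Z ^ 2 / (1 - γ) ^ 2 := by positivity
    have h3 : (1 / (1 - γ)) ^ 2 ≤ (1 / (1 - γ)) ^ 4 := pow_le_pow_right₀ hH (by norm_num)
    have h4 : 1 / 2 * (1 / (1 - γ)) ^ 4 ≤ Real.log nA * (1 / (1 - γ)) ^ 4 :=
      mul_le_mul_of_nonneg_right (by linarith) (by positivity)
    rw [hW]
    nlinarith [sq_nonneg (a - b)]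
  rw [mul_one_div, le_div_iff₀ (by positivity)]
  refine le_trans ?_ h1
  have := pow_le_pow_left₀ hacc.le hacc1 2
  linarith

/-- `W` is the sum of the squares of the three coefficients of `1 / √k` in the gap bound, and `(a +
b + c)² ≤ 3 (a² + b² + c²)`. -/
theorem sq_mul_lt_of_lt_gapBound (hA : 2 ≤ nA) (hk : 0 < k) (hγ : γ < 1) {Z acc : ℝ}
    (hacc : 0 < acc) (h : acc < gapBound nA k γ Z) :
    (k : ℝ) < 3 * (iterScale nA γ Z * (1 / acc ^ 2)) := by
  have hg : 0 < 1 - γ := sub_pos.2 hγ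
  have hζ := zetaStar_pos hA hγ
  have hk0 : (0 : ℝ) < k := Nat.cast_pos.2 hk
  have hy := Real.sqrt_pos.2 hk0
  have hk2 : (√k : ℝ) ^ 2 = k := Real.sq_sqrt hk0.le
  set a := Real.log nA / (zetaStar nA γ * (1 - γ)) with ha
  set b := zetaStar nA γ * (1 / (1 - γ)) ^ 2 / (2 * (1 - γ)) with hb
  set c := Z / (1 - γ) with hc
  have hW : iterScale nA γ Z = c ^ 2 + b ^ 2 + a ^ 2 := by
    rw [iterScale, ha, hb, hc]
    generalize 1 - γ = g
    ring
  have e : gapBound nA k γ Z = (a + b + c) / √k := by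
    rw [gapBound, ha, hb, hc]; field_simp
  rw [e, lt_div_iff₀ hy] at h
  have h2 : (acc * √k) ^ 2 < (a + b + c) ^ 2 := pow_lt_pow_left₀ h (by positivity) two_ne_zero
  rw [mul_pow, hk2] at h2
  rw [mul_one_div, ← mul_div_assoc, lt_div_iff₀ (by positivity), hW]
  nlinarith [sq_nonneg (a - b), sq_nonneg (b - c), sq_nonneg (a - c)]

theorem exists_iterations (hS : 1 ≤ nS) (hA : 2 ≤ nA) (hδ : 0 < δ) (hγ0 : 0 < γ) (hγ : γ < 1)
    {acc : ℝ} (hacc : 0 < acc) (hacc1 : acc ≤ 1 / (1 - γ)) :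
    ∃ k : ℕ, 2 ≤ k ∧ gapBound nA k γ (noiseZ nS k γ δ) ≤ acc ∧
      (k : ℝ) ≤ 5 * (iterScale nA γ (noiseZ nS k γ δ) * (1 / acc ^ 2)) := by
  classical
  have hex : ∃ k : ℕ, 2 ≤ k ∧ gapBound nA k γ (noiseZ nS k γ δ) ≤ acc :=
    ((eventually_ge_atTop 2).and
      ((tendsto_gapBound (nA := nA) (γ := γ) hS hδ).eventually_le_const hacc)).exists
  obtain ⟨h2, hgap⟩ := Nat.find_spec hex
  have hmin := fun m => Nat.find_min hex (m := m)
  set k := Nat.find hex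
  refine ⟨k, h2, hgap, ?_⟩
  have hhalf := half_le_iterScale hA hγ0 hγ (noiseZ nS k γ δ) hacc hacc1
  rcases h2.eq_or_lt with hk | hk
  · rw [← hk] at hhalf ⊢
    push_cast
    linarith
  -- Minimality gives `k - 1 < 3 Y` for `Y = W / acc²`, after passing from `Z` at `k - 1` to the
  -- larger `Z` at `k`; as `1 ≤ 2 Y`, this yields `k ≤ 5 Y`.
  · have hlt : acc < gapBound nA (k - 1) γ (noiseZ nS (k - 1 : ℕ) γ δ) := by
      by_contra hcon
      exact hmin (k - 1) (by omega) ⟨by omega, not_lt.1 hcon⟩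
    have h3 := sq_mul_lt_of_lt_gapBound hA (by omega : 0 < k - 1) hγ hacc hlt
    have hZ := noiseZ_mono hS hδ hγ (by omega : 0 < k - 1) (Nat.sub_le k 1)
    have hW : iterScale nA γ (noiseZ nS (k - 1 : ℕ) γ δ) ≤ iterScale nA γ (noiseZ nS k γ δ) := by
      have := pow_le_pow_left₀ (noiseZ_nonneg hγ) hZ 2
      unfold iterScale
      gcongr
    have h4 : iterScale nA γ (noiseZ nS (k - 1 : ℕ) γ δ) * (1 / acc ^ 2) ≤
        iterScale nA γ (noiseZ nS k γ δ) * (1 / acc ^ 2) :=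
      mul_le_mul_of_nonneg_right hW (by positivity)
    rw [Nat.cast_sub (by omega), Nat.cast_one] at h3
    linarith

theorem sampleScale_eq {C ρ νmin Z acc : ℝ} (hA : 2 ≤ nA) (hC : 0 < C) (hν : 0 < νmin) :
    sampleScale nA γ C ρ νmin Z acc =
      lengthScale γ C ρ νmin (threshold nA γ Z) * (iterScale nA γ Z * (1 / acc ^ 2)) := by
  have hA0 : (0 : ℝ) < nA := by positivity
  have hτ := threshold_pos (γ := γ) hA Z
  have e1 : Real.logb ρ (νmin * threshold nA γ Z / (2 * C)) =
      Real.logb ρ (νmin / (2 * C)) - (2 + Z) * Real.logb ρ nA / (1 - γ) := by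
    rw [mul_div_right_comm, Real.logb_mul (by positivity) hτ.ne', threshold,
      Real.logb_rpow_eq_mul_logb_of_pos hA0]
    ring
  have e2 : (nA : ℝ) ^ ((2 + Z) / (1 - γ)) = (threshold nA γ Z)⁻¹ := by
    rw [threshold, neg_div, Real.rpow_neg hA0.le, inv_inv]
  rw [sampleScale, lengthScale, mixTime, e1, e2, mul_assoc]
  congr 2
  field_simp

/-- Since `(2 + Z) / (1 - γ) ≥ 2`, already `1 / τ ≥ |A|²`. This lets `log |A|` be absorbed into `log
E`. -/
theorem sq_card_le_lengthScale {C ρ νmin Z : ℝ} (hA : 2 ≤ nA) (hγ0 : 0 < γ) (hγ : γ < 1)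
    (hν : 0 < νmin) (hν1 : νmin ≤ 1) (hZ : 0 ≤ Z) :
    (nA : ℝ) ^ 2 ≤ lengthScale γ C ρ νmin (threshold nA γ Z) := by
  have hg : 0 < 1 - γ := sub_pos.2 hγ
  have hA1 : (1 : ℝ) ≤ nA := by exact_mod_cast (by omega : 1 ≤ nA)
  have hτ := threshold_pos (γ := γ) hA Z
  have h1 : (nA : ℝ) ^ 2 ≤ 1 / threshold nA γ Z := by
    rw [threshold, neg_div, Real.rpow_neg (by linarith), one_div, inv_inv, ← Real.rpow_natCast]
    refine Real.rpow_le_rpow_of_exponent_le hA1 ?_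
    rw [le_div_iff₀ hg]
    push_cast
    linarith
  have h2 : 1 / threshold nA γ Z ≤ 1 / (νmin * threshold nA γ Z) :=
    one_div_le_one_div_of_le (mul_pos hν hτ) (mul_le_of_le_one_left hτ.le hν1)
  have h3 : 1 / (νmin * threshold nA γ Z) ≤
      (max 1 ⌈Real.logb ρ (νmin * threshold nA γ Z / (2 * C))⌉ : ℤ) / (νmin * threshold nA γ Z) :=
    div_le_div_of_nonneg_right (by exact_mod_cast le_max_left _ _) (mul_pos hν hτ).le
  have h4 : 0 ≤ 1 / (1 - γ) := by positivity
  unfold lengthScale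
  linarith

/-- Bounds `log (1 / ε)` by `log k`, hence by `log E`. Taking `k ≥ 2` keeps the logarithm inside `ε`
away from zero when `|S| = 1` and `δ` is close to 1. -/
theorem inv_biasLevel_le (hS : 1 ≤ nS) (hδ : 0 < δ) (hδ1 : δ < 1) (hγ0 : 0 < γ) (hγ : γ < 1)
    (hk : 2 ≤ k) : 0 < biasLevel nS k γ δ ∧ 1 / biasLevel nS k γ δ ≤ k := by
  have hg : 0 < 1 - γ := sub_pos.2 hγ
  have hk2 : (2 : ℝ) ≤ k := by exact_mod_cast hk
  have hS1 : (1 : ℝ) ≤ nS := by exact_mod_cast hS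
  have hr : 1 / 4 ≤ Real.log (nS * k / δ) := by
    have h1 : (2 : ℝ) ≤ nS * k / δ := by
      rw [le_div_iff₀ hδ]; nlinarith
    linarith [Real.log_le_log two_pos h1, Real.log_two_gt_d9]
  have h1 : 1 / k ≤ biasLevel nS k γ δ := by
    have h2 : 2 ≤ 2 / (1 - γ) := by rw [le_div_iff₀ hg]; linarith
    have h3 : 1 / (2 * (k : ℝ)) ≤ √(Real.log (nS * k / δ) / k) := by
      apply Real.le_sqrt_of_sq_le
      rw [div_pow, mul_pow, div_le_div_iff₀ (by positivity) (by positivity)]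
      nlinarith [mul_pos (show (0 : ℝ) < k by linarith) (show (0 : ℝ) < k by linarith)]
    calc (1 : ℝ) / k = 2 * (1 / (2 * k)) := by field_simp
      _ ≤ _ := mul_le_mul h2 h3 (by positivity) (by positivity)
  have h0 : 0 < biasLevel nS k γ δ := lt_of_lt_of_le (by positivity) h1
  refine ⟨h0, ?_⟩
  rw [div_le_iff₀ h0]
  rw [div_le_iff₀ (by positivity)] at h1
  linarith

/-- The total number of samples of `k ≤ 5 Y` iterations with trajectory length `n` of order
`trajLength`, in terms of `E = L * Y`. -/
theorem total_samples_le {L Y ε x y : ℝ} (hA : 2 ≤ nA) (hL : (nA : ℝ) ^ 2 ≤ L)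
    (hY : 1 / 2 ≤ Y) (hε : 0 < ε) (hεy : 1 / ε ≤ y) (hy0 : 0 ≤ y) (hy : y ≤ 5 * Y)
    (hx : x ≤ 2 + max 0 (6 * L * Real.log (nA / ε) * (1 + Real.log L))) :
    y * x ≤ 125 * (L * Y) * (1 + Real.log (L * Y)) ^ 2 := by
  have hA2 : (2 : ℝ) ≤ nA := by exact_mod_cast hA
  have hL4 : 4 ≤ L := by nlinarith
  have hAL : (nA : ℝ) ≤ L := by nlinarith
  set E := L * Y with hE
  have hE2 : 2 ≤ E := by nlinarith
  have hLE : L ≤ 2 * E := by nlinarith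
  have hyE : y ≤ 2 * E := by nlinarith
  have hl2 : Real.log 2 ≤ 1 := by linarith [Real.log_two_lt_d9]
  have hlog2E : Real.log (2 * E) ≤ 1 + Real.log E := by
    rw [Real.log_mul two_ne_zero (by linarith)]; linarith
  have hlE : 0 ≤ Real.log E := Real.log_nonneg (by linarith)
  have h1 : Real.log L ≤ 1 + Real.log E :=
    (Real.log_le_log (by linarith) hLE).trans hlog2E
  have h2 : Real.log (nA / ε) ≤ 2 * (1 + Real.log E) := by
    have h3 : (nA : ℝ) / ε ≤ (2 * E) * (2 * E) := by
      rw [← mul_one_div]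
      exact mul_le_mul (hAL.trans hLE) (hεy.trans hyE) (by positivity) (by linarith)
    have h4 := Real.log_le_log (by positivity) h3
    rw [Real.log_mul (by linarith) (by linarith)] at h4
    linarith
  have hl0 : 0 ≤ Real.log L := Real.log_nonneg (by linarith)
  set D := 1 + Real.log E with hD
  have hD1 : 1 ≤ D := by linarith
  have h5 : 6 * L * Real.log (nA / ε) * (1 + Real.log L) ≤ 24 * L * D ^ 2 := by
    calc _ = 6 * L * (1 + Real.log L) * Real.log (nA / ε) := by ring
      _ ≤ 6 * L * (1 + Real.log L) * (2 * D) := mul_le_mul_of_nonneg_left h2 (by positivity)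
      _ = 12 * L * D * (1 + Real.log L) := by ring
      _ ≤ 12 * L * D * (2 * D) := mul_le_mul_of_nonneg_left (by linarith) (by positivity)
      _ = _ := by ring
  -- `24 = 6 · 2 · 2` comes from the two logarithms, and one more `L D²` absorbs the rounding term
  -- 2; with `y ≤ 5 Y` the constant becomes 125.
  have h6 : x ≤ 25 * L * D ^ 2 := by
    have h7 : 2 ≤ L * D ^ 2 := by nlinarith [one_le_pow₀ hD1 (n := 2)]
    have h8 : max 0 (6 * L * Real.log (nA / ε) * (1 + Real.log L)) ≤ 24 * L * D ^ 2 :=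
      max_le (by positivity) h5
    linarith
  calc y * x ≤ y * (25 * L * D ^ 2) := mul_le_mul_of_nonneg_left h6 hy0
    _ ≤ 5 * Y * (25 * L * D ^ 2) := mul_le_mul_of_nonneg_right hy (by positivity)
    _ = _ := by rw [hE]; ring

end SampleComplexity

theorem MDP.HighProbGap.mono {S : Type u} {A : Type v} [Fintype S] [Fintype A]
    [DecidableEq S] [DecidableEq A] {M : MDP S A} {k n : ℕ} {δ C ρ νmin B B' : ℝ}
    (h : MDP.HighProbGap.{u, v, w} M k n δ C ρ νmin B) (hB : B ≤ B') :
    MDP.HighProbGap.{u, v, w} M k n δ C ρ νmin B' := by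
  intro Ω _ ℙ _ ξ pol hrun hmix
  refine (h Ω ℙ ξ pol hrun hmix).trans (MeasureTheory.measureReal_mono fun ω hω => ?_)
  exact fun θ hθ polStar hs => (hω θ hθ polStar hs).trans hB

end SPMD

/-! ### Assembly of the two claims. -/

theorem mainTheorem4 :
    ∃ (c₁ c₂ : ℝ) (p₁ p₂ : ℕ), 0 < c₁ ∧ 0 < c₂ ∧
      ∀ (S : Type u) (A : Type v) [Fintype S] [Fintype A] [DecidableEq S] [DecidableEq A]
        [Nonempty S] (M : SPMD.MDP S A) (δ C ρ νmin : ℝ),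
        2 ≤ Fintype.card A → 0 < δ → δ < 1 → 0 < C → 0 < ρ → ρ < 1 → 0 < νmin → νmin ≤ 1 →
        -- the optimality gap with high probability
        (∀ k n : ℕ, 0 < k → 0 < n →
          SPMD.trajLength c₁ p₁ (Fintype.card A) M.γ C ρ νmin
              (SPMD.threshold (Fintype.card A) M.γ (SPMD.noiseZ (Fintype.card S) k M.γ δ))
              (SPMD.biasLevel (Fintype.card S) k M.γ δ) ≤ n →
          SPMD.MDP.HighProbGap.{u, v, w} M k n δ C ρ νmin
            (SPMD.gapBound (Fintype.card A) k M.γ (SPMD.noiseZ (Fintype.card S) k M.γ δ))) ∧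
        -- the total number `k * n` of samples that attains accuracy `acc`
        (∀ acc : ℝ, 0 < acc → acc ≤ 1 / (1 - M.γ) →
          ∃ k n : ℕ, 0 < k ∧ 0 < n ∧
            SPMD.trajLength c₁ p₁ (Fintype.card A) M.γ C ρ νmin
              (SPMD.threshold (Fintype.card A) M.γ (SPMD.noiseZ (Fintype.card S) k M.γ δ))
              (SPMD.biasLevel (Fintype.card S) k M.γ δ) ≤ n ∧
            (k : ℝ) ≤ c₂ * SPMD.iterScale (Fintype.card A) M.γ
                (SPMD.noiseZ (Fintype.card S) k M.γ δ) * (1 / acc ^ 2) ∧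
            (k : ℝ) * n ≤
              c₂ * SPMD.sampleScale (Fintype.card A) M.γ C ρ νmin
                  (SPMD.noiseZ (Fintype.card S) k M.γ δ) acc *
                (1 + Real.log (SPMD.sampleScale (Fintype.card A) M.γ C ρ νmin
                  (SPMD.noiseZ (Fintype.card S) k M.γ δ) acc)) ^ p₂ ∧
            SPMD.MDP.HighProbGap.{u, v, w} M k n δ C ρ νmin acc) := by
  refine ⟨6, 125, 1, 2, by norm_num, by norm_num, ?_⟩
  intro S A _ _ _ _ _ M δ C ρ νmin hA hδ hδ1 hC hρ hρ1 hν hν1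
  refine ⟨fun k n hk hn hlen => M.highProbGap_gapBound hA hδ hδ1 hC hρ hρ1 hν hν1 hk hn hlen, ?_⟩
  intro acc hacc hacc1
  have hS : 1 ≤ Fintype.card S := Fintype.card_pos
  have hγ0 := M.γ_pos
  have hγ1 := M.γ_lt_one
  obtain ⟨k, hk, hgap, hkY⟩ := SPMD.exists_iterations hS hA hδ hγ0 hγ1 hacc hacc1
  set Z := SPMD.noiseZ (Fintype.card S) k M.γ δ with hZ
  set τ := SPMD.threshold (Fintype.card A) M.γ Z with hτ
  set ε := SPMD.biasLevel (Fintype.card S) k M.γ δ with hε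
  set ℓ := SPMD.trajLength 6 1 (Fintype.card A) M.γ C ρ νmin τ ε with hℓ
  have hZ0 : 0 ≤ Z := SPMD.noiseZ_nonneg hγ1
  have hℓn : ℓ ≤ (⌈ℓ⌉₊ + 1 : ℕ) := by
    push_cast
    linarith [Nat.le_ceil ℓ]
  obtain ⟨hε0, hεk⟩ := SPMD.inv_biasLevel_le hS hδ hδ1 hγ0 hγ1 hk
  have hhalf := SPMD.half_le_iterScale hA hγ0 hγ1 Z hacc hacc1
  -- The added 1 keeps the length positive even when `ℓ ≤ 0`, where the natural ceiling is `0`.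
  refine ⟨k, ⌈ℓ⌉₊ + 1, by omega, Nat.succ_pos _, hℓn, ?_, ?_,
    (M.highProbGap_gapBound hA hδ hδ1 hC hρ hρ1 hν hν1 (by omega) (Nat.succ_pos _) hℓn).mono hgap⟩
  · rw [mul_assoc]
    linarith
  · rw [SPMD.sampleScale_eq hA hC hν]
    refine SPMD.total_samples_le hA (SPMD.sq_card_le_lengthScale hA hγ0 hγ1 hν hν1 hZ0) hhalf hε0
      hεk (Nat.cast_nonneg k) hkY ?_
    have h1 : (⌈ℓ⌉₊ : ℝ) ≤ 1 + max 0 ℓ := by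
      rcases le_or_gt ℓ 0 with h | h
      · rw [Nat.ceil_eq_zero.2 h, Nat.cast_zero]
        positivity
      · linarith [Nat.ceil_lt_add_one h.le, le_max_right 0 ℓ]
    rw [hℓ, SPMD.trajLength, pow_one] at h1
    rw [hℓ, SPMD.trajLength, pow_one]
    push_cast
    linarith
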